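/- \textbf{Setting.} Let $G$ be a $d$-regular graph on $n$ vertices, $d\ge 1$, each vertex of which holds one of two opinions $A,B$; write $A,B$ also for the numbers of vertices with these opinions. In one step of \emph{two-sample voting}, all vertices simultaneously and independently choose two random neighbours; a vertex whose two sampled neighbours have the same opinion adopts it, and otherwise it keeps its own opinion. The two neighbours may be sampled uniformly with replacement or uniformly without replacement. An \emph{adversary}, who knows the graph and the whole history of opinions, chooses the initial placement of the opinions and may, at the beginning of each step, rearrange the current opinions arbitrarily over the vertices, without changing the number of opinions of each type. Voting is \emph{completed} when all vertices hold the same opinion, and this opinion \emph{wins}. Let $\nu_0=|A-B|/n$ be the initial imbalance. \textbf{Statement (sparse random graphs).} There are absolute constants $K>0$ and $C>0$ (independent of $n$ and $d$) such that for every $\varepsilon>0$ there is an $N$ with the following property. Let $n\ge N$, let $1\le d\le\sqrt n$ be such that $d$-regular graphs on $n$ vertices exist, and let $G$ be chosen uniformly at random from the $d$-regular simple graphs on $\{1,\dots,n\}$. Then with probability at least $1-\varepsilon$ the graph $G$ is such that, for both ways of sampling, for every initial placement of the opinions with $$\nu_0\ \ge\ \frac{K}{\sqrt d},$$ and for every strategy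 of the adversary, with probability at least $1-\varepsilon$ two-sample voting on $G$ is completed within $C\log n$ steps and the winner is the opinion with the initial majority. -/

import Mathlib

noncomputable section

namespace TwoSampleVoting

/-- Probability that a random element with law `p` satisfies `P`. -/
def prob {α : Type*} (p : PMF α) (P : α → Prop) : ℝ :=
  (p.toOuterMeasure {x | P x}).toReal

/-! ### Random regular graphs -/

open Classical in
/-- The `d`-regular simple graphs on the vertex set `{0, …, n - 1}`. -/
def RegularGraph (n d : ℕ) : Type :=
  {G : SimpleGraph (Fin n) // G.IsRegularOfDegree d}

instance (n d : ℕ) : Finite (RegularGraph n d) :=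
  inferInstanceAs (Finite (Subtype _))

instance (n d : ℕ) : Fintype (RegularGraph n d) := Fintype.ofFinite _

/-- The random `d`-regular graph on `n` labelled vertices: the uniform law on the
`d`-regular graphs (assumed to exist). -/
def randomRegularGraph (n d : ℕ) [Nonempty (RegularGraph n d)] : PMF (RegularGraph n d) :=
  PMF.uniformOfFintype (RegularGraph n d)

/-! ### Opinions -/

/-- A placement of the two opinions `true` and `false` on the vertices. -/
abbrev Config (V : Type*) := V → Bool

variable {V : Type*} [Fintype V]

/-- The number of vertices which hold opinion `a`. -/
def votes (x : Config V) (a : Bool) : ℕ := (Finset.univ.filter fun v => x v = a).card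

/-- The imbalance `ν = |A - B| / n`. -/
def imbalance (x : Config V) : ℝ :=
  |(votes x true : ℝ) - (votes x false : ℝ)| / (Fintype.card V : ℝ)

/-- `a` is the (strict) majority opinion. -/
def IsMajority (x : Config V) (a : Bool) : Prop := votes x (!a) < votes x a

/-- All vertices hold opinion `a`. -/
def Unanimous (x : Config V) (a : Bool) : Prop := ∀ v, x v = a

/-! ### One step of two-sample voting -/

/-- The two neighbours are chosen with or without replacement. -/
inductive SamplingRule where
  | withReplacement
  | withoutReplacement

open Classical in
/-- The ordered pairs of neighbours which a vertex `v` may sample. -/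
def samplePairs (r : SamplingRule) (G : SimpleGraph V) (v : V) : Finset (V × V) :=
  match r with
  | .withReplacement => G.neighborFinset v ×ˢ G.neighborFinset v
  | .withoutReplacement => (G.neighborFinset v).offDiag

open Classical in
/-- The possible joint samples of all vertices. The uniform law on this product set
lets the vertices sample independently, each uniformly from its own pairs. -/
def samples (r : SamplingRule) (G : SimpleGraph V) : Finset (V → V × V) :=
  Fintype.piFinset (samplePairs r G)

/-- If the two sampled neighbours agree, the vertex adopts their opinion;
otherwise it keeps its own. All vertices revise synchronously. -/
def revise (x : Config V) (s : V → V × V) : Config V :=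
  fun v => if x (s v).1 = x (s v).2 then x (s v).1 else x v

open Classical in
/-- The law of the opinions after one voting step from `x`. If some vertex has no pair to
sample (no neighbours, or just one when sampling without replacement), nothing happens. -/
def stepLaw (r : SamplingRule) (G : SimpleGraph V) (x : Config V) : PMF (Config V) :=
  if h : (samples r G).Nonempty then (PMF.uniformOfFinset (samples r G) h).map (revise x)
  else PMF.pure x

/-! ### The adversary and the voting process -/

/-- An adversary: given the opinions `h 0, …, h t` at times `0, …, t`, it names the opinions
from which the next voting step starts. -/
abbrev Adversary (V : Type*) := (t : ℕ) → (Fin (t + 1) → Config V) → Config V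

/-- The adversary only redistributes the current opinions over the vertices: it does not
change the number of opinions of each type. -/
def Adversary.Redistributes (σ : Adversary V) : Prop :=
  ∀ (t : ℕ) (h : Fin (t + 1) → Config V) (a : Bool),
    votes (σ t h) a = votes (h (Fin.last t)) a

/-- The law of the opinions at times `0, …, t`, starting from `x₀`: before each step the
adversary redistributes the opinions, then all vertices vote. -/
def votingLaw (r : SamplingRule) (G : SimpleGraph V) (σ : Adversary V) (x₀ : Config V) :
    (t : ℕ) → PMF (Fin (t + 1) → Config V)
  | 0 => PMF.pure fun _ => x₀
  | t + 1 => (votingLaw r G σ x₀ t).bind fun h =>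
      (stepLaw r G (σ t h)).map fun y => Fin.snoc (α := fun _ => Config V) h y

/-- Voting on `G` from `x₀` against `σ` is completed within `T` steps with winner `a`,
with probability at least `p`. -/
def WinsWithin (r : SamplingRule) (G : SimpleGraph V) (σ : Adversary V) (x₀ : Config V)
    (a : Bool) (T : ℕ) (p : ℝ) : Prop :=
  p ≤ prob (votingLaw r G σ x₀ T) fun h => ∃ t : Fin (T + 1), Unanimous (h t) a

end TwoSampleVoting

end

noncomputable section

namespace TwoSampleVoting

/-! Let `b` be the minority opinion, `B` its set of holders, `β = |B|/n`, and `ν = 1 - 2β` the lead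
against it. If a fraction `f v` of the neighbours of `v` lies in `B`, then after one step `v` holds
`b` with probability about `f v ^ 2` if `v ∉ B`, and about `1 - (1 - f v) ^ 2` if `v ∈ B`. Were
every `f v` equal to `β`, the expected size of the new minority would be `|B| (1 - (1 + ν) ν / 2)`.

The adversary can only make `f` deviate from `β`, and `WellMixed` limits this for all sets at once:
between any two sets there are at most `c √d n` more edges than the density predicts, so the
deviations cost `O(n / √d)` votes in all. A lead `ν ≥ K / √d` absorbs this while `|B| > δ n`; for
smaller `B` the sparsity of small sets takes over. Hence `WellMixed.sum_adoptFraction_le`: the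
expected minority is at most `(1 - ν / 4) |B|` for every placement. This depends on the placement
only through its vote counts, which the adversary cannot change.

By a Chernoff bound the lead grows by the factor `17 / 16` per step until it reaches `1 / 2`
(`expect_lead_lt_le`); from then on the expected minority shrinks by `7 / 8` per step
(`expect_votes_last_le`), and after `O(log n)` steps it is below `ε`, so Markov's inequality gives
unanimity.

That random regular graphs are well mixed (`card_not_wellMixed_le`) rests on switchings: a given
edge set `F` of moderate size is present with probability at most `(d² / D) ^ |F|`, where `D` is
close to `n d` (`card_containing_mul_le`). A union bound over subsets of the pairs between two sets
gives tails strong enough for a union bound over all pairs of sets. For bounded `d` the constant `K`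
makes the hypothesis on the imbalance unsatisfiable. -/

/-- Expectation of a real function under a law on a finite type. -/
def expect {α : Type*} [Fintype α] (p : PMF α) (f : α → ℝ) : ℝ := ∑ a, (p a).toReal * f a

/-! ### Expectations under finite laws. -/

section Expect

variable {α β : Type*} [Fintype α] [Fintype β]

open Classical in
lemma prob_eq_expect (p : PMF α) (P : α → Prop) :
    prob p P = expect p fun a => if P a then 1 else 0 := by
  unfold prob expect
  rw [PMF.toOuterMeasure_apply_fintype, ENNReal.toReal_sum]
  · refine Finset.sum_congr rfl fun a _ => ?_
    by_cases h : P a <;> simp [Set.indicator, h]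
  · intro a _
    by_cases h : P a <;> simp [Set.indicator, h, PMF.apply_ne_top]

lemma expect_mono (p : PMF α) {f g : α → ℝ} (h : ∀ a, f a ≤ g a) : expect p f ≤ expect p g :=
  Finset.sum_le_sum fun a _ => mul_le_mul_of_nonneg_left (h a) ENNReal.toReal_nonneg

lemma sum_toReal_eq_one (p : PMF α) : ∑ a, (p a).toReal = 1 := by
  rw [← ENNReal.toReal_sum fun a _ => p.apply_ne_top a, ← tsum_fintype (L := .unconditional _),
    p.tsum_coe, ENNReal.toReal_one]

lemma expect_const (p : PMF α) (c : ℝ) : expect p (fun _ => c) = c := by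
  simp [expect, ← Finset.sum_mul, sum_toReal_eq_one]

lemma expect_add (p : PMF α) (f g : α → ℝ) :
    expect p (fun a => f a + g a) = expect p f + expect p g := by
  simp [expect, mul_add, Finset.sum_add_distrib]

lemma expect_mul_left (p : PMF α) (c : ℝ) (f : α → ℝ) :
    expect p (fun a => c * f a) = c * expect p f := by
  simp [expect, Finset.mul_sum, mul_left_comm]

lemma expect_pure (a : α) (f : α → ℝ) : expect (PMF.pure a) f = f a := by
  classical
  simp [expect, PMF.pure_apply, apply_ite ENNReal.toReal, ite_mul]

lemma expect_bind (p : PMF α) (q : α → PMF β) (f : β → ℝ) :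
    expect (p.bind q) f = expect p fun a => expect (q a) f := by
  unfold expect
  simp_rw [PMF.bind_apply, tsum_fintype]
  simp_rw [ENNReal.toReal_sum fun a _ =>
    ENNReal.mul_ne_top (p.apply_ne_top a) ((q a).apply_ne_top _), ENNReal.toReal_mul,
    Finset.sum_mul, Finset.mul_sum]
  rw [Finset.sum_comm]
  simp_rw [mul_assoc]

lemma expect_map (p : PMF α) (g : α → β) (f : β → ℝ) :
    expect (p.map g) f = expect p fun a => f (g a) := by
  rw [← PMF.bind_pure_comp, expect_bind]
  simp [expect_pure]

lemma expect_uniformOfFinset (s : Finset α) (hs : s.Nonempty) (f : α → ℝ) :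
    expect (PMF.uniformOfFinset s hs) f = (∑ a ∈ s, f a) / s.card := by
  classical
  unfold expect
  simp_rw [PMF.uniformOfFinset_apply, apply_ite ENNReal.toReal, ite_mul]
  simp only [ENNReal.toReal_zero, zero_mul]
  rw [← Finset.sum_filter, Finset.sum_div]
  simp [div_eq_inv_mul]

open Classical in
lemma prob_uniformOfFintype [Nonempty α] (P : α → Prop) :
    prob (PMF.uniformOfFintype α) P
      = ((Finset.univ.filter P).card : ℝ) / Fintype.card α := by
  rw [prob_eq_expect, PMF.uniformOfFintype, expect_uniformOfFinset]
  simp [Finset.sum_boole]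

end Expect

/-! ### One voting step: product structure and concentration. -/

section Step

variable {V : Type*} [Fintype V]

open Classical in
/-- The fraction of the sample pairs of `v` which give `v` the opinion `b`. -/
def adoptFraction (r : SamplingRule) (G : SimpleGraph V) (x : Config V) (b : Bool) (v : V) : ℝ :=
  (((samplePairs r G v).filter fun p => (if x p.1 = x p.2 then x p.1 else x v) = b).card : ℝ)
    / (samplePairs r G v).card

open Classical in
lemma adoptFraction_eq_sum (r : SamplingRule) (G : SimpleGraph V) (x : Config V) (b : Bool)
    (v : V) (c e : ℝ) (h : (samplePairs r G v).Nonempty) :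
    (∑ p ∈ samplePairs r G v, if (if x p.1 = x p.2 then x p.1 else x v) = b then c else e)
      / (samplePairs r G v).card = e + adoptFraction r G x b v * (c - e) := by
  have hc : ((samplePairs r G v).card : ℝ) ≠ 0 := by
    exact_mod_cast h.card_pos.ne'
  have hs : ∀ p ∈ samplePairs r G v,
      (if (if x p.1 = x p.2 then x p.1 else x v) = b then c else e)
        = e + (if (if x p.1 = x p.2 then x p.1 else x v) = b then 1 else 0) * (c - e) := by
    intro p _
    split_ifs <;> ring
  rw [Finset.sum_congr rfl hs, Finset.sum_add_distrib, ← Finset.sum_mul, Finset.sum_boole]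
  unfold adoptFraction
  simp only [Finset.sum_const, nsmul_eq_mul]
  field_simp

variable [DecidableEq V]

/-- Independence of the vertices: the uniform law on a product set factorises. Both the marginals
and the exponential moments come from this formula. -/
lemma expect_stepLaw_prod (r : SamplingRule) (G : SimpleGraph V) (x : Config V)
    (h : ∀ v, (samplePairs r G v).Nonempty) (g : V → Bool → ℝ) :
    expect (stepLaw r G x) (fun y => ∏ v, g v (y v)) = ∏ v,
      (∑ p ∈ samplePairs r G v, g v (if x p.1 = x p.2 then x p.1 else x v))
        / (samplePairs r G v).card := by
  have hs : samples r G = Fintype.piFinset (samplePairs r G) := by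
    unfold samples
    congr!
  have hne : (samples r G).Nonempty := hs ▸ Fintype.piFinset_nonempty.2 h
  unfold stepLaw
  rw [dif_pos hne, expect_map, expect_uniformOfFinset, Finset.prod_div_distrib,
    Finset.prod_univ_sum, hs, Fintype.card_piFinset, Nat.cast_prod]
  rfl

open Classical in
lemma expect_votes (r : SamplingRule) (G : SimpleGraph V) (x : Config V) (b : Bool)
    (h : ∀ v, (samplePairs r G v).Nonempty) :
    expect (stepLaw r G x) (fun y => (votes y b : ℝ)) = ∑ v, adoptFraction r G x b v := by
  have h1 : ∀ v, expect (stepLaw r G x) (fun y => if y v = b then (1 : ℝ) else 0)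
      = adoptFraction r G x b v := by
    intro v
    have := expect_stepLaw_prod r G x h
      -- The indicator of a single vertex is a product with all other factors equal to `1`.
      (fun w c => if w = v then (if c = b then (1 : ℝ) else 0) else 1)
    have e1 : ∀ y : Config V, (∏ w, if w = v then (if y w = b then (1 : ℝ) else 0) else 1)
        = if y v = b then 1 else 0 := by
      intro y
      rw [Finset.prod_ite_eq' Finset.univ v]
      simp
    simp only [e1] at this
    rw [this, Finset.prod_eq_single v]
    · simpa using adoptFraction_eq_sum r G x b v 1 0 (h v)
    · intro w _ hw
      have : ((samplePairs r G w).card : ℝ) ≠ 0 := by exact_mod_cast (h w).card_pos.ne'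
      simp [hw, this]
    · simp
  simp_rw [← h1]
  unfold expect
  rw [Finset.sum_comm]
  refine Finset.sum_congr rfl fun y _ => ?_
  rw [← Finset.mul_sum, Finset.sum_boole]
  rfl

/-- The moment is a product of factors `1 + a (exp θ - 1)`, each at most `exp (a (exp θ - 1))`, and
`exp θ - 1 ≤ θ + θ ^ 2` on `[0, 1]`. -/
lemma expect_exp_votes_le (r : SamplingRule) (G : SimpleGraph V) (x : Config V) (b : Bool)
    (h : ∀ v, (samplePairs r G v).Nonempty) {θ : ℝ} (h0 : 0 ≤ θ) (h1 : θ ≤ 1) :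
    expect (stepLaw r G x) (fun y => Real.exp (θ * votes y b))
      ≤ Real.exp ((θ + θ ^ 2) * ∑ v, adoptFraction r G x b v) := by
  classical
  have e1 : ∀ y : Config V, Real.exp (θ * votes y b)
      = ∏ v, (if y v = b then Real.exp θ else 1) := by
    intro y
    rw [Finset.prod_ite]
    simp only [Finset.prod_const, one_pow, mul_one]
    rw [← Real.exp_nat_mul, mul_comm]
    rfl
  simp_rw [e1]
  rw [expect_stepLaw_prod r G x h fun _ c => if c = b then Real.exp θ else 1, Finset.mul_sum,
    Real.exp_sum]
  refine Finset.prod_le_prod (fun v _ => ?_) fun v _ => ?_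
  · refine div_nonneg (Finset.sum_nonneg fun p _ => ?_) (Nat.cast_nonneg _)
    split_ifs <;> positivity
  · rw [adoptFraction_eq_sum r G x b v _ _ (h v)]
    have ha : 0 ≤ adoptFraction r G x b v := by unfold adoptFraction; positivity
    have he : Real.exp θ - 1 ≤ θ + θ ^ 2 := by
      have := Real.abs_exp_sub_one_sub_id_le (x := θ) (by rwa [abs_of_nonneg h0])
      linarith [(abs_le.1 this).2]
    have := Real.add_one_le_exp (adoptFraction r G x b v * (Real.exp θ - 1))
    refine (le_trans (by linarith) this).trans (Real.exp_le_exp.2 ?_)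
    rw [mul_comm]
    exact mul_le_mul_of_nonneg_right he ha

open Classical in
/-- Chernoff bound for the number of votes after one step. -/
lemma expect_votes_gt_le (r : SamplingRule) (G : SimpleGraph V) (x : Config V) (b : Bool)
    (h : ∀ v, (samplePairs r G v).Nonempty) {n s μ : ℝ} (hn : 0 < n) (hs : 0 ≤ s) (hsn : s ≤ 2 * n)
    (hμ : ∑ v, adoptFraction r G x b v ≤ μ) (hμn : μ ≤ n) :
    expect (stepLaw r G x) (fun y => if μ + s ≤ (votes y b : ℝ) then 1 else 0)
      ≤ Real.exp (-(s ^ 2 / (4 * n))) := by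
  -- This minimises the exponent `θ ^ 2 * n - θ * s`; the assumption `s ≤ 2 * n` is what gives `θ ≤
  -- 1`.
  set θ := s / (2 * n) with hθ
  have h0 : 0 ≤ θ := by positivity
  have h1 : θ ≤ 1 := by rw [hθ, div_le_one (by positivity)]; exact hsn
  have hmain : ∀ y : Config V, (if μ + s ≤ (votes y b : ℝ) then (1 : ℝ) else 0)
      ≤ Real.exp (-(θ * (μ + s))) * Real.exp (θ * votes y b) := by
    intro y
    rw [← Real.exp_add]
    split_ifs with hy
    · apply Real.one_le_exp
      have := mul_le_mul_of_nonneg_left hy h0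
      linarith
    · positivity
  refine (expect_mono _ hmain).trans ?_
  rw [expect_mul_left]
  refine (mul_le_mul_of_nonneg_left (expect_exp_votes_le r G x b h h0 h1)
    (Real.exp_nonneg _)).trans ?_
  rw [← Real.exp_add, Real.exp_le_exp]
  have h2 : (θ + θ ^ 2) * ∑ v, adoptFraction r G x b v ≤ (θ + θ ^ 2) * μ := by gcongr
  have h3 : θ ^ 2 * μ ≤ θ ^ 2 * n := by gcongr
  have h4 : θ ^ 2 * n - θ * s = -(s ^ 2 / (4 * n)) := by
    rw [hθ]; field_simp; ring
  linarith

end Step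

/-! ### Adoption probabilities in terms of neighbour counts. -/

section Drift

variable {V : Type*}

open Classical in
/-- The number of neighbours of `v` in `B`. -/
def nbrIn (G : SimpleGraph V) (v : V) (B : Finset V) : ℕ := (B.filter (G.Adj v)).card

open Classical in
lemma nbrIn_mono (G : SimpleGraph V) (v : V) {B C : Finset V} (h : B ⊆ C) :
    nbrIn G v B ≤ nbrIn G v C :=
  Finset.card_le_card (Finset.filter_subset_filter _ h)

variable [Fintype V]

/-- The vertices which hold opinion `b`. -/
def holders (x : Config V) (b : Bool) : Finset V := Finset.univ.filter fun v => x v = b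

lemma mem_holders (x : Config V) (b : Bool) (v : V) : v ∈ holders x b ↔ x v = b := by
  simp [holders]

lemma card_holders (x : Config V) (b : Bool) : (holders x b).card = votes x b := rfl

lemma disjoint_holders (x : Config V) (b : Bool) : Disjoint (holders x (!b)) (holders x b) := by
  rw [Finset.disjoint_left]
  intro v h1 h2
  rw [mem_holders] at h1 h2
  simp [h1] at h2

lemma nbrIn_add (G : SimpleGraph V) (v : V) (x : Config V) (b : Bool) :
    nbrIn G v (holders x b) + nbrIn G v (holders x (!b)) = nbrIn G v Finset.univ := by
  classical
  unfold nbrIn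
  rw [← Finset.card_union_of_disjoint]
  · congr 1
    ext w
    simp only [Finset.mem_union, Finset.mem_filter, mem_holders, Finset.mem_univ, true_and]
    cases x w <;> cases b <;> simp
  · exact Finset.disjoint_filter_filter (disjoint_holders x b).symm

lemma votes_add (x : Config V) (b : Bool) :
    votes x b + votes x (!b) = Fintype.card V := by
  classical
  rw [← card_holders, ← card_holders, ← Finset.card_union_of_disjoint (disjoint_holders x b).symm,
    ← Finset.card_univ]
  congr 1
  ext w
  simp only [Finset.mem_union, mem_holders, Finset.mem_univ, iff_true]
  cases x w <;> cases b <;> simp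

lemma card_samplePairs_withReplacement (G : SimpleGraph V) (v : V) :
    (samplePairs .withReplacement G v).card = nbrIn G v Finset.univ * nbrIn G v Finset.univ := by
  unfold samplePairs nbrIn
  rw [Finset.card_product]
  congr 2 <;> (ext w; simp)

lemma card_samplePairs_withoutReplacement (G : SimpleGraph V) (v : V) :
    (samplePairs .withoutReplacement G v).card
      = nbrIn G v Finset.univ * nbrIn G v Finset.univ - nbrIn G v Finset.univ := by
  unfold samplePairs nbrIn
  rw [Finset.offDiag_card]
  congr 3 <;> (ext w; simp)

open Classical in
lemma card_agree_withReplacement (G : SimpleGraph V) (v : V) (x : Config V) (c : Bool) :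
    ((samplePairs .withReplacement G v).filter fun p => x p.1 = c ∧ x p.2 = c).card
      = nbrIn G v (holders x c) * nbrIn G v (holders x c) := by
  unfold nbrIn
  rw [← Finset.card_product]
  congr 1
  ext p
  simp only [samplePairs, Finset.mem_filter, Finset.mem_product, SimpleGraph.mem_neighborFinset,
    mem_holders]
  tauto

open Classical in
lemma card_agree_withoutReplacement (G : SimpleGraph V) (v : V) (x : Config V) (c : Bool) :
    ((samplePairs .withoutReplacement G v).filter fun p => x p.1 = c ∧ x p.2 = c).card
      = nbrIn G v (holders x c) * nbrIn G v (holders x c) - nbrIn G v (holders x c) := by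
  unfold nbrIn
  rw [← Finset.offDiag_card]
  congr 1
  ext p
  simp only [samplePairs, Finset.mem_filter, Finset.mem_offDiag, SimpleGraph.mem_neighborFinset,
    mem_holders]
  tauto

lemma samplePairs_nonempty (r : SamplingRule) (G : SimpleGraph V) (v : V)
    (h : 2 ≤ nbrIn G v Finset.univ) : (samplePairs r G v).Nonempty := by
  rw [← Finset.card_pos]
  cases r
  · rw [card_samplePairs_withReplacement]
    positivity
  · rw [card_samplePairs_withoutReplacement]
    have : 2 * nbrIn G v Finset.univ ≤ nbrIn G v Finset.univ * nbrIn G v Finset.univ :=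
      Nat.mul_le_mul_right _ h
    omega

open Classical in
/-- The fraction of the sample pairs of `v` which both hold opinion `c` is close to the square of
the fraction of the neighbours with opinion `c`. -/
lemma agree_fraction_bounds (r : SamplingRule) (G : SimpleGraph V) (v : V) (x : Config V)
    (c : Bool) {d : ℕ} (hd : 2 ≤ d) (hv : nbrIn G v Finset.univ = d) :
    (((samplePairs r G v).filter fun p => x p.1 = c ∧ x p.2 = c).card : ℝ)
        / (samplePairs r G v).card ≤ ((nbrIn G v (holders x c) : ℝ) / d) ^ 2 ∧
    ((nbrIn G v (holders x c) : ℝ) / d) ^ 2 - 1 / d ≤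
      (((samplePairs r G v).filter fun p => x p.1 = c ∧ x p.2 = c).card : ℝ)
        / (samplePairs r G v).card := by
  have hle : nbrIn G v (holders x c) ≤ d := hv ▸ nbrIn_mono G v (Finset.subset_univ _)
  have hd' : (2 : ℝ) ≤ d := by exact_mod_cast hd
  have hle' : (nbrIn G v (holders x c) : ℝ) ≤ d := by exact_mod_cast hle
  cases r
  · rw [card_agree_withReplacement, card_samplePairs_withReplacement, hv]
    have : ((nbrIn G v (holders x c) * nbrIn G v (holders x c) : ℕ) : ℝ) / ((d * d : ℕ) : ℝ)
        = ((nbrIn G v (holders x c) : ℝ) / d) ^ 2 := by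
      push_cast
      field_simp
    rw [this]
    have : (0 : ℝ) ≤ 1 / d := by positivity
    exact ⟨le_rfl, by linarith⟩
  · rw [card_agree_withoutReplacement, card_samplePairs_withoutReplacement, hv,
      Nat.cast_sub (Nat.le_mul_self _), Nat.cast_sub (Nat.le_mul_self _)]
    push_cast
    set D : ℝ := (nbrIn G v (holders x c) : ℝ)
    have hD : 0 ≤ D := Nat.cast_nonneg _
    have h1 : (0 : ℝ) < d - 1 := by linarith
    -- Sampling without replacement lowers the agreement probability by a term which is at most `1 /
    -- d`, because `D (d - D) ≤ d² / 4 ≤ d (d - 1)`.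
    have e1 : (D * D - D) / ((d : ℝ) * d - d) = (D / d) ^ 2 - D * (d - D) / (d ^ 2 * (d - 1)) := by
      have h2 : (d : ℝ) * d - d = d * (d - 1) := by ring
      rw [h2]
      field_simp
      ring
    rw [e1]
    have h3 : 0 ≤ D * (d - D) / ((d : ℝ) ^ 2 * (d - 1)) := by
      have : 0 ≤ (d : ℝ) - D := by linarith
      positivity
    have h4 : D * (d - D) / ((d : ℝ) ^ 2 * (d - 1)) ≤ 1 / d := by
      rw [div_le_div_iff₀ (by positivity) (by positivity)]
      have h5 : D * (d - D) ≤ d * (d - 1) := by nlinarith [sq_nonneg (2 * D - d)]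
      calc D * (d - D) * d ≤ (d * (d - 1)) * d := by gcongr
        _ = 1 * ((d : ℝ) ^ 2 * (d - 1)) := by ring
    exact ⟨by linarith, by linarith⟩

lemma adoptFraction_le_of_ne (r : SamplingRule) (G : SimpleGraph V) (v : V) (x : Config V)
    (b : Bool) {d : ℕ} (hd : 2 ≤ d) (hv : nbrIn G v Finset.univ = d) (hx : x v = !b) :
    adoptFraction r G x b v ≤ ((nbrIn G v (holders x b) : ℝ) / d) ^ 2 := by
  classical
  refine le_trans (le_of_eq ?_) (agree_fraction_bounds r G v x b hd hv).1
  unfold adoptFraction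
  congr 3
  ext p
  simp only [Finset.mem_filter, hx]
  cases x p.1 <;> cases x p.2 <;> cases b <;> simp

/-- A holder of `b` abandons it only when both samples oppose it. This needs the lower bound on
agreement, hence the extra `1 / d`. -/
lemma adoptFraction_le_of_eq (r : SamplingRule) (G : SimpleGraph V) (v : V) (x : Config V)
    (b : Bool) {d : ℕ} (hd : 2 ≤ d) (hv : nbrIn G v Finset.univ = d) (hx : x v = b) :
    adoptFraction r G x b v ≤ 1 - (1 - (nbrIn G v (holders x b) : ℝ) / d) ^ 2 + 1 / d := by
  classical
  have h := (agree_fraction_bounds r G v x (!b) hd hv).2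
  have hadd := nbrIn_add G v x b
  rw [hv] at hadd
  have hd0 : (d : ℝ) ≠ 0 := by positivity
  have hcomp : (nbrIn G v (holders x (!b)) : ℝ) / d = 1 - (nbrIn G v (holders x b) : ℝ) / d := by
    have : (nbrIn G v (holders x b) : ℝ) + nbrIn G v (holders x (!b)) = d := by exact_mod_cast hadd
    field_simp
    linarith
  have hne : ((samplePairs r G v).card : ℝ) ≠ 0 := by
    exact_mod_cast (samplePairs_nonempty r G v (hv ▸ hd)).card_pos.ne'
  have e : adoptFraction r G x b v = 1 -
      (((samplePairs r G v).filter fun p => x p.1 = !b ∧ x p.2 = !b).card : ℝ)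
        / (samplePairs r G v).card := by
    have hs := Finset.card_filter_add_card_filter_not (s := samplePairs r G v)
      (fun p => x p.1 = !b ∧ x p.2 = !b)
    have hf : (samplePairs r G v).filter (fun p => (if x p.1 = x p.2 then x p.1 else x v) = b)
        = (samplePairs r G v).filter (fun p => ¬(x p.1 = !b ∧ x p.2 = !b)) := by
      ext p
      simp only [Finset.mem_filter, hx]
      cases x p.1 <;> cases x p.2 <;> cases b <;> simp
    have hs' : (((samplePairs r G v).filter fun p => x p.1 = !b ∧ x p.2 = !b).card : ℝ)
        + ((samplePairs r G v).filter fun p => ¬(x p.1 = !b ∧ x p.2 = !b)).card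
        = (samplePairs r G v).card := by exact_mod_cast hs
    unfold adoptFraction
    rw [hf]
    field_simp
    linarith
  rw [e, ← hcomp]
  linarith

lemma sum_adoptFraction_le (r : SamplingRule) (G : SimpleGraph V) (x : Config V) (b : Bool)
    {d : ℕ} (hd : 2 ≤ d) (hv : ∀ v, nbrIn G v Finset.univ = d) :
    ∑ v, adoptFraction r G x b v ≤
      ∑ v ∈ holders x (!b), ((nbrIn G v (holders x b) : ℝ) / d) ^ 2 +
      ∑ v ∈ holders x b, (1 - (1 - (nbrIn G v (holders x b) : ℝ) / d) ^ 2 + 1 / d) := by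
  classical
  have hu : (Finset.univ : Finset V) = (holders x (!b)).disjUnion (holders x b)
      (disjoint_holders x b) := by
    ext w
    simp only [Finset.mem_disjUnion, mem_holders, Finset.mem_univ, true_iff]
    cases x w <;> cases b <;> simp
  rw [hu, Finset.sum_disjUnion]
  refine add_le_add (Finset.sum_le_sum fun v h => ?_) (Finset.sum_le_sum fun v h => ?_)
  · exact adoptFraction_le_of_ne r G v x b hd (hv v) ((mem_holders _ _ _).1 h)
  · exact adoptFraction_le_of_eq r G v x b hd (hv v) ((mem_holders _ _ _).1 h)

/-- Few edges of `G` join any two sets of vertices, and very few small ones. -/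
structure WellMixed (G : SimpleGraph V) (d : ℕ) (c δ : ℝ) : Prop where
  regular : ∀ v, nbrIn G v Finset.univ = d
  cross : ∀ S B : Finset V, Disjoint S B → (∑ v ∈ S, (nbrIn G v B : ℝ))
    ≤ d * (B.card / Fintype.card V : ℝ) * S.card + c * Real.sqrt d * Fintype.card V
  inner : ∀ B : Finset V, (∑ v ∈ B, (nbrIn G v B : ℝ))
    ≤ d * (B.card / Fintype.card V : ℝ) * B.card + c * Real.sqrt d * Fintype.card V
  cross_small : ∀ S B : Finset V, Disjoint S B → (B.card : ℝ) ≤ δ * Fintype.card V →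
    S.card ≤ 8 * B.card → (∑ v ∈ S, (nbrIn G v B : ℝ)) ≤ d * B.card / 8
  inner_small : ∀ B : Finset V, (B.card : ℝ) ≤ δ * Fintype.card V →
    (∑ v ∈ B, (nbrIn G v B : ℝ)) ≤ d * B.card / 8

end Drift

/-! ### The expected minority on a well mixed graph. -/

section Drift

variable {V : Type*}

/-- On `A`, `f² - β² = (f - β)(f + β)` is at most twice the positive part of `f - β`, and the
hypothesis is applied to the set where `f` exceeds `β`. On `B`, the concave function `1 - (1 - f)²`
lies below its tangent at `β`, whose slope is nonnegative, so an upper bound for the total of `f`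
suffices. -/
lemma sum_sq_le_of_large {A B : Finset V} (f : V → ℝ) (hf0 : ∀ v, 0 ≤ f v) (hf1 : ∀ v, f v ≤ 1)
    {β E e : ℝ} (h0 : 0 ≤ β) (h1 : β ≤ 1) (hE : 0 ≤ E)
    (hA : ∀ S ⊆ A, ∑ v ∈ S, f v ≤ β * S.card + E) (hB : ∑ v ∈ B, f v ≤ β * B.card + E) :
    ∑ v ∈ A, f v ^ 2 + ∑ v ∈ B, (1 - (1 - f v) ^ 2 + e) ≤
      β ^ 2 * A.card + B.card * (1 - (1 - β) ^ 2) + 4 * E + B.card * e := by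
  have hA' : ∑ v ∈ A, f v ^ 2 ≤ β ^ 2 * A.card + 2 * E := by
    have hpt : ∀ v ∈ A, f v ^ 2 ≤ β ^ 2 + 2 * (if β < f v then f v - β else 0) := by
      intro v _
      split_ifs with h
      · nlinarith [hf1 v, hf0 v]
      · nlinarith [hf1 v, hf0 v, not_lt.1 h]
    refine (Finset.sum_le_sum hpt).trans ?_
    rw [Finset.sum_add_distrib, ← Finset.mul_sum, ← Finset.sum_filter, Finset.sum_sub_distrib]
    have := hA (A.filter fun v => β < f v) (Finset.filter_subset _ _)
    simp only [Finset.sum_const, nsmul_eq_mul]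
    linarith
  have hB' : ∑ v ∈ B, (1 - (1 - f v) ^ 2 + e)
      ≤ B.card * (1 - (1 - β) ^ 2) + 2 * E + B.card * e := by
    have hpt : ∀ v ∈ B, 1 - (1 - f v) ^ 2 + e
        ≤ (1 - 2 * (1 - β) + (1 - β) ^ 2 + e) + 2 * (1 - β) * f v := by
      intro v _
      nlinarith [sq_nonneg (f v - β)]
    refine (Finset.sum_le_sum hpt).trans ?_
    rw [Finset.sum_add_distrib, ← Finset.mul_sum]
    simp only [Finset.sum_const, nsmul_eq_mul]
    have h2 : 2 * (1 - β) * ∑ v ∈ B, f v ≤ 2 * (1 - β) * (β * B.card + E) :=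
      mul_le_mul_of_nonneg_left hB (by linarith)
    nlinarith
  linarith

/-- Where `f ≤ 1/8`, squaring gains a factor `8`. The remaining vertices of `A` number at most `8
|B|`, so the small-set hypothesis controls them. In all `1/8 + 1/8` from `A` and `1/16 + 2/8` from
`B`, below `3/4`. -/
lemma sum_sq_le_of_small {A B : Finset V} (f : V → ℝ) (hf0 : ∀ v, 0 ≤ f v) (hf1 : ∀ v, f v ≤ 1)
    {e : ℝ} (he : e ≤ 1 / 16) (hsum : ∑ v ∈ A, f v ≤ B.card)
    (hA : ∀ S ⊆ A, S.card ≤ 8 * B.card → ∑ v ∈ S, f v ≤ B.card / 8)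
    (hB : ∑ v ∈ B, f v ≤ (B.card : ℝ) / 8) :
    ∑ v ∈ A, f v ^ 2 + ∑ v ∈ B, (1 - (1 - f v) ^ 2 + e) ≤ 3 / 4 * B.card := by
  have hA' : ∑ v ∈ A, f v ^ 2 ≤ 1 / 4 * B.card := by
    have hpt : ∀ v ∈ A, f v ^ 2 ≤ 1 / 8 * f v + (if 1 / 8 < f v then f v else 0) := by
      intro v _
      split_ifs with h
      · nlinarith [hf1 v, hf0 v]
      · nlinarith [hf1 v, hf0 v, not_lt.1 h]
    refine (Finset.sum_le_sum hpt).trans ?_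
    rw [Finset.sum_add_distrib, ← Finset.mul_sum, ← Finset.sum_filter]
    have hcard : (A.filter fun v => 1 / 8 < f v).card ≤ 8 * B.card := by
      have h1 : ((A.filter fun v => 1 / 8 < f v).card : ℝ) * (1 / 8)
          ≤ ∑ v ∈ A.filter (fun v => 1 / 8 < f v), f v := by
        rw [← nsmul_eq_mul]
        exact Finset.card_nsmul_le_sum _ _ _ fun v hv => (Finset.mem_filter.1 hv).2.le
      have h2 : ∑ v ∈ A.filter (fun v => 1 / 8 < f v), f v ≤ ∑ v ∈ A, f v :=
        Finset.sum_le_sum_of_subset_of_nonneg (Finset.filter_subset _ _) fun v _ _ => hf0 v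
      have h3 : ((A.filter fun v => 1 / 8 < f v).card : ℝ) ≤ 8 * B.card := by linarith
      exact_mod_cast h3
    have := hA _ (Finset.filter_subset (fun v => 1 / 8 < f v) A) hcard
    linarith
  have hB' : ∑ v ∈ B, (1 - (1 - f v) ^ 2 + e) ≤ B.card * e + 2 * ∑ v ∈ B, f v := by
    have hpt : ∀ v ∈ B, 1 - (1 - f v) ^ 2 + e ≤ e + 2 * f v := by
      intro v _
      nlinarith [sq_nonneg (f v)]
    refine (Finset.sum_le_sum hpt).trans ?_
    rw [Finset.sum_add_distrib, ← Finset.mul_sum]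
    simp
  have : (B.card : ℝ) * e ≤ B.card * (1 / 16) := by gcongr
  have hb : (0 : ℝ) ≤ B.card := Nat.cast_nonneg _
  linarith

lemma sum_nbrIn_comm (G : SimpleGraph V) (S B : Finset V) :
    ∑ v ∈ S, nbrIn G v B = ∑ v ∈ B, nbrIn G v S := by
  classical
  unfold nbrIn
  simp_rw [Finset.card_filter]
  rw [Finset.sum_comm]
  simp_rw [G.adj_comm]

variable [Fintype V]

/-- On a well mixed graph the expected minority shrinks in one step. -/
lemma WellMixed.sum_adoptFraction_le {G : SimpleGraph V} {d : ℕ} {c δ K : ℝ}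
    (hG : WellMixed G d c δ) (r : SamplingRule) (x : Config V) (b : Bool) (hd : 16 ≤ d)
    (hc : 1 ≤ c) (hδ : 0 < δ) (hK : 20 * c ≤ K * δ) (hV : 0 < Fintype.card V) {ν : ℝ}
    (hν : ν = 1 - 2 * votes x b / Fintype.card V) (hνK : K / Real.sqrt d ≤ ν) :
    ∑ v, adoptFraction r G x b v ≤ (1 - ν / 4) * votes x b := by
  have hK0 : 0 < K := by
    by_contra h
    have : K * δ ≤ 0 := mul_nonpos_of_nonpos_of_nonneg (not_lt.1 h) hδ.le
    linarith
  have hdR : (16 : ℝ) ≤ d := by exact_mod_cast hd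
  have hsd : 0 < Real.sqrt d := Real.sqrt_pos.2 (by linarith)
  have hsq : Real.sqrt d * Real.sqrt d = d := Real.mul_self_sqrt (by linarith)
  have hs4 : 1 ≤ Real.sqrt d := by nlinarith
  set n : ℝ := (Fintype.card V : ℝ) with hn
  have hn0 : 0 < n := by rw [hn]; exact_mod_cast hV
  set B : ℝ := (votes x b : ℝ) with hB
  have hB0 : 0 ≤ B := Nat.cast_nonneg _
  have hν0 : 0 < ν := lt_of_lt_of_le (by positivity) hνK
  have hcardA : ((holders x (!b)).card : ℝ) = n - B := by
    have := votes_add x b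
    rw [card_holders, hn, hB, ← this]
    push_cast
    ring
  have hν1 : ν ≤ 1 := by
    rw [hν]
    have : 0 ≤ 2 * B / n := by positivity
    linarith
  have hBn : B = n * (1 - ν) / 2 := by
    rw [hν]; field_simp; ring
  set f : V → ℝ := fun v => (nbrIn G v (holders x b) : ℝ) / d with hf
  have hf0 : ∀ v, 0 ≤ f v := fun v => by positivity
  have hf1 : ∀ v, f v ≤ 1 := by
    intro v
    rw [hf]
    simp only
    rw [div_le_one (by linarith), ← hG.regular v]
    exact_mod_cast nbrIn_mono G v (Finset.subset_univ _)
  have hfsum : ∀ S : Finset V, ∑ v ∈ S, f v = (∑ v ∈ S, (nbrIn G v (holders x b) : ℝ)) / d := by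
    intro S
    rw [hf, Finset.sum_div]
  refine (TwoSampleVoting.sum_adoptFraction_le r G x b (by omega) hG.regular).trans ?_
  have hsub : ∀ S ⊆ holders x (!b), Disjoint S (holders x b) := fun S hS =>
    Finset.disjoint_of_subset_left hS (disjoint_holders x b)
  -- The edge error `c √d n` is harmless only against a `B` of linear size; below `δ n` the
  -- small-set bounds give the factor `3/4 ≤ 1 - ν / 4`.
  by_cases hsmall : B ≤ δ * n
  · have h1 := sum_sq_le_of_small (A := holders x (!b)) (B := holders x b) f hf0 hf1
      (e := 1 / d) (one_div_le_one_div_of_le (by norm_num) hdR) ?_ ?_ ?_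
    · refine h1.trans ?_
      rw [card_holders]
      gcongr
      linarith
    · rw [hfsum, div_le_iff₀ (by linarith)]
      have h2 := sum_nbrIn_comm G (holders x (!b)) (holders x b)
      have h3 : ∑ v ∈ holders x b, nbrIn G v (holders x (!b)) ≤ (holders x b).card * d := by
        rw [← smul_eq_mul]
        exact Finset.sum_le_card_nsmul _ _ _ fun v _ =>
          (nbrIn_mono G v (Finset.subset_univ _)).trans (hG.regular v).le
      rw [← h2] at h3
      exact_mod_cast h3
    · intro S hS hcard
      rw [hfsum, div_le_iff₀ (by linarith)]
      have := hG.cross_small S (holders x b) (hsub S hS) hsmall hcard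
      linarith
    · rw [hfsum, div_le_iff₀ (by linarith)]
      have := hG.inner_small (holders x b) hsmall
      linarith
  · have hlarge : δ * n < B := not_le.1 hsmall
    set E : ℝ := c * n / Real.sqrt d with hE
    have hE0 : 0 ≤ E := by positivity
    have hEd : c * Real.sqrt d * n = E * d := by
      calc c * Real.sqrt d * n = c * n / Real.sqrt d * (Real.sqrt d * Real.sqrt d) := by
            field_simp
        _ = E * d := by rw [hsq]
    have h1 := sum_sq_le_of_large (A := holders x (!b)) (B := holders x b) f hf0 hf1
      (β := B / n) (E := E) (e := 1 / d) (by positivity)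
      (by rw [div_le_one hn0, hBn]; nlinarith) hE0 ?_ ?_
    · refine h1.trans ?_
      rw [hcardA, card_holders, ← hB]
      -- The ideal value, with `f` constantly equal to `β = (1 - ν) / 2`.
      have e1 : (B / n) ^ 2 * (n - B) + B * (1 - (1 - B / n) ^ 2) = B * (1 - (1 + ν) / 2 * ν) := by
        have : B / n = (1 - ν) / 2 := by rw [hBn]; field_simp
        have h4 : (B / n) ^ 2 * (n - B) = (B / n) * B * (1 - B / n) := by field_simp
        rw [h4, this]; ring
      rw [e1]
      have h5 : B * (1 / d) ≤ E := by
        rw [hE, mul_one_div, div_le_div_iff₀ (by linarith) hsd]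
        have h6 : B ≤ n := by rw [hBn]; nlinarith
        calc B * Real.sqrt d ≤ n * Real.sqrt d := by gcongr
          _ ≤ n * d := by
            gcongr
            nlinarith
          _ ≤ c * n * d := by
            have : 0 ≤ n * d := by positivity
            nlinarith
      -- Four `E` come from the deviations of `f` and one from the `1 / d` loss; `B > δ n` and `ν ≥
      -- K / √d` absorb them.
      have h7 : 5 * E ≤ B * ν / 4 := by
        have h8 : 20 * E ≤ δ * n * ν := by
          calc 20 * E = (20 * c) * (n / Real.sqrt d) := by rw [hE]; ring
            _ ≤ (K * δ) * (n / Real.sqrt d) := by gcongr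
            _ = δ * n * (K / Real.sqrt d) := by ring
            _ ≤ δ * n * ν := by gcongr
        have : δ * n * ν ≤ B * ν := by gcongr
        linarith
      have e2 : B * (1 - (1 + ν) / 2 * ν) = B - B * ν / 2 - B * ν ^ 2 / 2 := by ring
      have e3 : (1 - ν / 4) * B = B - B * ν / 4 := by ring
      have h9 : 0 ≤ B * ν ^ 2 := by positivity
      rw [e2, e3]
      linarith
    · intro S hS
      rw [hfsum, div_le_iff₀ (by linarith)]
      have := hG.cross S (holders x b) (hsub S hS)
      rw [card_holders, ← hn, ← hB, hEd] at this
      refine this.trans (le_of_eq ?_)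
      ring
    · rw [hfsum, div_le_iff₀ (by linarith)]
      have := hG.inner (holders x b)
      rw [← hn, hEd] at this
      refine this.trans (le_of_eq ?_)
      rw [card_holders]
      ring

end Drift

/-! ### The voting process against the adversary. -/

section Dynamics

variable {V : Type*} [Fintype V]

/-- The lead of the opponents of opinion `b`, as a fraction of all vertices. -/
def leadOver (x : Config V) (b : Bool) : ℝ := 1 - 2 * votes x b / Fintype.card V

/-- The opinion `b` is expected to lose a fraction of its holders in one step. -/
def Shrinks (r : SamplingRule) (G : SimpleGraph V) (b : Bool) (ν : ℝ) : Prop :=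
  ∀ x : Config V, ν ≤ leadOver x b →
    ∑ v, adoptFraction r G x b v ≤ (1 - leadOver x b / 4) * votes x b

lemma votes_le_card (x : Config V) (b : Bool) : votes x b ≤ Fintype.card V := by
  have := votes_add x b
  omega

lemma votes_eq_leadOver (hV : 0 < Fintype.card V) (x : Config V) (b : Bool) :
    (votes x b : ℝ) = Fintype.card V * (1 - leadOver x b) / 2 := by
  have : (0 : ℝ) < Fintype.card V := by exact_mod_cast hV
  unfold leadOver
  field_simp
  ring

variable [DecidableEq V]

/-- Conditioning on the whole history fixes the adversary's move, so one-step bounds uniform in the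
placement can be iterated. -/
lemma expect_votingLaw_succ (r : SamplingRule) (G : SimpleGraph V) (σ : Adversary V)
    (x₀ : Config V) (t : ℕ) (f : Config V → ℝ) :
    expect (votingLaw r G σ x₀ (t + 1)) (fun h => f (h (Fin.last (t + 1))))
      = expect (votingLaw r G σ x₀ t) fun h => expect (stepLaw r G (σ t h)) f := by
  rw [votingLaw, expect_bind]
  congr 1
  ext h
  rw [expect_map]
  simp

open Classical in
lemma expect_lead_drop_le {r : SamplingRule} {G : SimpleGraph V} {b : Bool} {ν : ℝ}
    (hV : 0 < Fintype.card V) (hne : ∀ v, (samplePairs r G v).Nonempty)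
    (hG : Shrinks r G b ν) (h0 : 0 < ν) (h1 : ν ≤ 1 / 2) (t : ℕ) (x : Config V)
    (hx : min (1 / 2) (ν * (17 / 16) ^ t) ≤ leadOver x b) :
    expect (stepLaw r G x)
      (fun y => if leadOver y b < min (1 / 2) (ν * (17 / 16) ^ (t + 1)) then 1 else 0)
      ≤ Real.exp (-(Fintype.card V * ν ^ 2 / 16384)) := by
  set n : ℝ := (Fintype.card V : ℝ) with hn
  have hn0 : 0 < n := by rw [hn]; exact_mod_cast hV
  have hpow : (1 : ℝ) ≤ (17 / 16) ^ t := one_le_pow₀ (by norm_num)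
  have hνl : ν ≤ leadOver x b := le_trans (le_min h1 (by nlinarith)) hx
  set l := leadOver x b with hl
  have hB := votes_eq_leadOver hV x b
  rw [← hn, ← hl] at hB
  have hB0 : (0 : ℝ) ≤ votes x b := Nat.cast_nonneg _
  have hl1 : l ≤ 1 := by
    by_contra h
    have : n * (1 - l) < 0 := mul_neg_of_pos_of_neg hn0 (by linarith)
    linarith
  have hμn : (1 - l / 4) * (votes x b : ℝ) ≤ n := by
    have : (votes x b : ℝ) ≤ n := by rw [hn]; exact_mod_cast votes_le_card x b
    nlinarith
  -- A fluctuation of `n ν / 64` votes changes the lead by `ν / 32`. The drift raises `l` by `l (1 -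
  -- l) / 4`, which is at least `l / 8` for `l ≤ 1/2`; what is left exceeds `l / 16`.
  have hch := expect_votes_gt_le r G x b hne (s := n * ν / 64) hn0 (by positivity) (by nlinarith)
    (hG x hνl) hμn
  have he : (n * ν / 64) ^ 2 / (4 * n) = n * ν ^ 2 / 16384 := by
    field_simp
    norm_num
  rw [he] at hch
  refine (expect_mono _ fun y => ?_).trans hch
  split_ifs with hy hy' hy'
  · exact le_rfl
  · exfalso
    rw [not_le, votes_eq_leadOver hV y b, ← hn, hB] at hy'
    have hy2 : 1 - leadOver y b < (1 - l / 4) * (1 - l) + ν / 32 := by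
      have : n * (1 - leadOver y b) < n * ((1 - l / 4) * (1 - l) + ν / 32) := by linarith
      exact lt_of_mul_lt_mul_left this hn0.le
    -- From `l ≥ 1/2` the drift leads to at least `9/16`, so the fluctuation cannot bring the lead
    -- below `1/2`.
    by_cases hcase : 1 / 2 ≤ l
    · have := hy.trans_le (min_le_left _ _)
      nlinarith
    · rw [not_le] at hcase
      have hx2 : ν * (17 / 16) ^ t ≤ l := by
        rcases min_le_iff.1 hx with h | h
        · linarith
        · exact h
      have := hy.trans_le (min_le_right _ _)
      rw [pow_succ] at this
      nlinarith
  · exact zero_le_one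
  · exact le_rfl

-- Union bound over the steps: each step that starts above the threshold falls short of the next one
-- with exponentially small probability, and redistribution leaves `leadOver` unchanged.
open Classical in
lemma expect_lead_lt_le {r : SamplingRule} {G : SimpleGraph V} {b : Bool} {ν : ℝ}
    (hV : 0 < Fintype.card V) (hne : ∀ v, (samplePairs r G v).Nonempty)
    (hG : Shrinks r G b ν) (h0 : 0 < ν) (h1 : ν ≤ 1 / 2) (σ : Adversary V)
    (hσ : σ.Redistributes) (x₀ : Config V) (hx₀ : ν ≤ leadOver x₀ b) (t : ℕ) :
    expect (votingLaw r G σ x₀ t) (fun h =>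
      if leadOver (h (Fin.last t)) b < min (1 / 2) (ν * (17 / 16) ^ t) then 1 else 0)
      ≤ t * Real.exp (-(Fintype.card V * ν ^ 2 / 16384)) := by
  induction t with
  | zero =>
    have : ¬ leadOver x₀ b < min (1 / 2) (ν * (17 / 16) ^ 0) := by
      rw [not_lt]
      refine (min_le_right _ _).trans ?_
      simpa using hx₀
    rw [votingLaw, expect_pure, if_neg this]
    simp
  | succ t ih =>
    rw [expect_votingLaw_succ r G σ x₀ t
      fun y => if leadOver y b < min (1 / 2) (ν * (17 / 16) ^ (t + 1)) then 1 else 0]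
    have hpt : ∀ h : Fin (t + 1) → Config V, expect (stepLaw r G (σ t h))
        (fun y => if leadOver y b < min (1 / 2) (ν * (17 / 16) ^ (t + 1)) then 1 else 0)
        ≤ (if leadOver (h (Fin.last t)) b < min (1 / 2) (ν * (17 / 16) ^ t) then 1 else 0)
          + Real.exp (-(Fintype.card V * ν ^ 2 / 16384)) := by
      intro h
      split_ifs with hh
      · have : expect (stepLaw r G (σ t h))
            (fun y => if leadOver y b < min (1 / 2) (ν * (17 / 16) ^ (t + 1)) then (1 : ℝ) else 0)
            ≤ 1 := by
          refine (expect_mono _ (g := fun _ => 1) fun y => ?_).trans (expect_const _ 1).le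
          split_ifs <;> norm_num
        have := Real.exp_nonneg (-(Fintype.card V * ν ^ 2 / 16384))
        linarith
      · rw [zero_add]
        refine expect_lead_drop_le hV hne hG h0 h1 t _ ?_
        unfold leadOver at hh ⊢
        rw [hσ t h b]
        exact not_lt.1 hh
    refine (expect_mono _ hpt).trans ?_
    rw [expect_add, expect_const]
    push_cast
    linarith

/-- Once the lead is at least `1/2` the drift factor is at most `7/8`. On the exceptional event the
votes are bounded by `n`; the term `k (T₁ + k)` generously covers the accumulated failure
probabilities. -/
lemma expect_votes_last_le {r : SamplingRule} {G : SimpleGraph V} {b : Bool} {ν : ℝ}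
    (hV : 0 < Fintype.card V) (hne : ∀ v, (samplePairs r G v).Nonempty)
    (hG : Shrinks r G b ν) (h0 : 0 < ν) (h1 : ν ≤ 1 / 2) (σ : Adversary V)
    (hσ : σ.Redistributes) (x₀ : Config V) (hx₀ : ν ≤ leadOver x₀ b) {T₁ : ℕ}
    (hT₁ : 1 / 2 ≤ ν * (17 / 16) ^ T₁) (k : ℕ) :
    expect (votingLaw r G σ x₀ (T₁ + k)) (fun h => (votes (h (Fin.last (T₁ + k))) b : ℝ))
      ≤ Fintype.card V * (7 / 8) ^ k + Fintype.card V * (k * (T₁ + k)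
        * Real.exp (-(Fintype.card V * ν ^ 2 / 16384))) := by
  classical
  set n : ℝ := (Fintype.card V : ℝ) with hn
  have hn0 : 0 < n := by rw [hn]; exact_mod_cast hV
  set p := Real.exp (-(n * ν ^ 2 / 16384)) with hp
  have hp0 : 0 ≤ p := Real.exp_nonneg _
  have hle : ∀ y : Config V, (votes y b : ℝ) ≤ n := fun y => by rw [hn]; exact_mod_cast votes_le_card y b
  induction k with
  | zero =>
    refine (expect_mono _ fun h => hle _).trans ?_
    rw [expect_const]
    simp
  | succ k ih =>
    have hs := expect_votingLaw_succ r G σ x₀ (T₁ + k) (fun y => (votes y b : ℝ))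
    rw [← add_assoc, hs]
    have hpt : ∀ h : Fin (T₁ + k + 1) → Config V,
        expect (stepLaw r G (σ (T₁ + k) h)) (fun y => (votes y b : ℝ))
        ≤ 7 / 8 * (votes (h (Fin.last (T₁ + k))) b : ℝ) + n *
          (if leadOver (h (Fin.last (T₁ + k))) b < min (1 / 2) (ν * (17 / 16) ^ (T₁ + k))
            then 1 else 0) := by
      intro h
      have hv := hσ (T₁ + k) h b
      split_ifs with hh
      · refine (expect_mono _ hle).trans ?_
        rw [expect_const]
        have : (0 : ℝ) ≤ votes (h (Fin.last (T₁ + k))) b := Nat.cast_nonneg _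
        linarith
      · have hpow : ν * (17 / 16) ^ T₁ ≤ ν * (17 / 16) ^ (T₁ + k) := by
          gcongr
          · norm_num
          · omega
        rw [min_eq_left (hT₁.trans hpow), not_lt] at hh
        have hl : leadOver (σ (T₁ + k) h) b = leadOver (h (Fin.last (T₁ + k))) b := by
          unfold leadOver
          rw [hv]
        rw [expect_votes r G _ b hne]
        refine (hG _ (by rw [hl]; linarith)).trans ?_
        rw [hl, hv, mul_zero, add_zero]
        gcongr
        linarith
    refine (expect_mono _ hpt).trans ?_
    rw [expect_add, expect_mul_left, expect_mul_left]
    have hd := expect_lead_lt_le hV hne hG h0 h1 σ hσ x₀ hx₀ (T₁ + k)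
    rw [← hn, ← hp] at hd
    have h3 := mul_le_mul_of_nonneg_left hd hn0.le
    push_cast at h3 ⊢
    have h4 : n * (7 / 8 : ℝ) ^ (k + 1) = 7 / 8 * (n * (7 / 8) ^ k) := by ring
    have h5 : 0 ≤ n * (k * (T₁ + k) * p) := by positivity
    have h6 : n * ((k + 1) * (T₁ + (k + 1)) * p) = n * (k * (T₁ + k) * p)
        + n * ((T₁ + k) * p) + n * ((k + 1) * p) := by ring
    have h7 : 0 ≤ n * ((k + 1) * p) := by positivity
    rw [h4, h6]
    linarith

lemma winsWithin_of_shrinks {r : SamplingRule} {G : SimpleGraph V} {a : Bool} {ν : ℝ}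
    (hV : 0 < Fintype.card V) (hne : ∀ v, (samplePairs r G v).Nonempty)
    (hG : Shrinks r G (!a) ν) (h0 : 0 < ν) (h1 : ν ≤ 1 / 2) (σ : Adversary V)
    (hσ : σ.Redistributes) (x₀ : Config V) (hx₀ : ν ≤ leadOver x₀ (!a)) {T₁ : ℕ}
    (hT₁ : 1 / 2 ≤ ν * (17 / 16) ^ T₁) (k : ℕ) {ε : ℝ}
    (hε : Fintype.card V * (7 / 8) ^ k + Fintype.card V * (k * (T₁ + k)
        * Real.exp (-(Fintype.card V * ν ^ 2 / 16384))) ≤ ε) :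
    WinsWithin r G σ x₀ a (T₁ + k) (1 - ε) := by
  classical
  unfold WinsWithin
  rw [prob_eq_expect]
  have hM := (expect_votes_last_le hV hne hG h0 h1 σ hσ x₀ hx₀ hT₁ k).trans hε
  -- Markov's inequality: the number of opposing votes is an integer, so the indicator of unanimity
  -- is at least `1` minus this number.
  have hsum : expect (votingLaw r G σ x₀ (T₁ + k)) (fun h => 1 +
      (-1) * (votes (h (Fin.last (T₁ + k))) (!a) : ℝ)) ≥ 1 - ε := by
    rw [expect_add, expect_const, expect_mul_left]
    linarith
  refine le_trans hsum (expect_mono _ fun h => ?_)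
  split_ifs with hh
  · have : (0 : ℝ) ≤ votes (h (Fin.last (T₁ + k))) (!a) := Nat.cast_nonneg _
    linarith
  · have : 1 ≤ votes (h (Fin.last (T₁ + k))) (!a) := by
      rw [Nat.one_le_iff_ne_zero]
      intro h0
      refine hh ⟨Fin.last _, fun v => ?_⟩
      unfold votes at h0
      rw [Finset.card_eq_zero, Finset.filter_eq_empty_iff] at h0
      have := h0 (Finset.mem_univ v)
      revert this
      cases h (Fin.last (T₁ + k)) v <;> cases a <;> simp
    have : (1 : ℝ) ≤ votes (h (Fin.last (T₁ + k))) (!a) := by exact_mod_cast this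
    linarith

end Dynamics

/-! ### Switchings of two edges. -/

section Switching

variable {V : Type*}

open Classical in
/-- The graph obtained from `G` by exchanging the edges `uv`, `xy` for `ux`, `vy`. -/
def switch (G : SimpleGraph V) (u v x y : V) : SimpleGraph V :=
  SimpleGraph.fromEdgeSet ((G.edgeSet \ {s(u, v), s(x, y)}) ∪ {s(u, x), s(v, y)})

/-- The edges `uv`, `xy` of `G` may be exchanged for the non-edges `ux`, `vy`. -/
structure Switchable (G : SimpleGraph V) (u v x y : V) : Prop where
  uv : G.Adj u v
  xy : G.Adj x y
  ux : u ≠ x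
  vy : v ≠ y
  not_ux : ¬ G.Adj u x
  not_vy : ¬ G.Adj v y

variable {G : SimpleGraph V} {u v x y : V}

lemma Switchable.edgeSet_switch (h : Switchable G u v x y) :
    (switch G u v x y).edgeSet = (G.edgeSet \ {s(u, v), s(x, y)}) ∪ {s(u, x), s(v, y)} := by
  unfold switch
  rw [SimpleGraph.edgeSet_fromEdgeSet, sdiff_eq_left, Set.disjoint_left]
  rintro e (he | he) hd
  · exact G.not_isDiag_of_mem_edgeSet he.1 (by simpa using hd)
  · have := h.ux
    have := h.vy
    simp only [Set.mem_insert_iff, Set.mem_singleton_iff] at he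
    rcases he with rfl | rfl <;> simp_all

lemma Switchable.ne_uy (h : Switchable G u v x y) : u ≠ y := by
  rintro rfl
  exact h.not_vy h.uv.symm

/-- A switching can be undone: the four vertices and the new graph determine the old one. This
supplies the injectivity in `sum_card_switchings_le`. -/
lemma Switchable.edgeSet_eq (h : Switchable G u v x y) :
    G.edgeSet = ((switch G u v x y).edgeSet \ {s(u, x), s(v, y)}) ∪ {s(u, v), s(x, y)} := by
  have h1 : s(u, x) ∉ G.edgeSet := h.not_ux
  have h2 : s(v, y) ∉ G.edgeSet := h.not_vy
  have h3 : s(u, v) ∈ G.edgeSet := h.uv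
  have h4 : s(x, y) ∈ G.edgeSet := h.xy
  rw [h.edgeSet_switch]
  ext e
  simp only [Set.mem_union, Set.mem_sdiff, Set.mem_insert_iff, Set.mem_singleton_iff]
  by_cases e1 : e = s(u, v)
  · subst e1; simp [h3]
  by_cases e2 : e = s(x, y)
  · subst e2; simp [h4]
  by_cases e3 : e = s(u, x)
  · subst e3; simp_all
  by_cases e4 : e = s(v, y)
  · subst e4; simp_all
  simp_all

variable [Fintype V]

open Classical in
lemma Switchable.nbrIn_switch (h : Switchable G u v x y) (w : V) :
    nbrIn (switch G u v x y) w Finset.univ = nbrIn G w Finset.univ := by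
  -- The edge `ab` adds one to the degree of `c` exactly when `c` is an endpoint. The two removed
  -- and the two added edges have the same endpoints, so the contributions cancel.
  have key : ∀ (a b c : V), a ≠ b → (∑ z, if s(c, z) = s(a, b) then (1 : ℤ) else 0)
      = (if c = a then 1 else 0) + if c = b then 1 else 0 := by
    intro a b c hab
    by_cases h1 : c = a
    · subst h1
      simp [hab]
    · by_cases h2 : c = b
      · subst h2
        simp [h1]
      · simp [h1, h2]
  have h1 : s(u, x) ∉ G.edgeSet := h.not_ux
  have h2 : s(v, y) ∉ G.edgeSet := h.not_vy
  have h3 : s(u, v) ∈ G.edgeSet := h.uv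
  have h4 : s(x, y) ∈ G.edgeSet := h.xy
  have n1 : s(u, v) ≠ s(x, y) := by
    have := h.ux; have := h.vy; have := h.ne_uy; simp_all
  have n2 : s(u, x) ≠ s(v, y) := by
    have := h.ne_uy; have := h.uv.ne; simp_all
  have n3 : s(u, v) ≠ s(u, x) := fun h' => h1 (h' ▸ h3)
  have n4 : s(u, v) ≠ s(v, y) := fun h' => h2 (h' ▸ h3)
  have n5 : s(x, y) ≠ s(u, x) := fun h' => h1 (h' ▸ h4)
  have n6 : s(x, y) ≠ s(v, y) := fun h' => h2 (h' ▸ h4)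
  have hpt : ∀ z, (if (switch G u v x y).Adj w z then (1 : ℤ) else 0)
      = (if G.Adj w z then 1 else 0) - (if s(w, z) = s(u, v) then 1 else 0)
        - (if s(w, z) = s(x, y) then 1 else 0) + (if s(w, z) = s(u, x) then 1 else 0)
        + (if s(w, z) = s(v, y) then 1 else 0) := by
    intro z
    rw [← SimpleGraph.mem_edgeSet, ← SimpleGraph.mem_edgeSet, h.edgeSet_switch]
    generalize s(w, z) = e
    simp only [Set.mem_union, Set.mem_sdiff, Set.mem_insert_iff, Set.mem_singleton_iff]
    by_cases e1 : e = s(u, v)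
    · subst e1; simp [h3, n1, n3, n4]
    by_cases e2 : e = s(x, y)
    · subst e2; simp [h4, n1.symm, n5, n6]
    by_cases e3 : e = s(u, x)
    · subst e3; simp [h1, n2, e1, e2]
    by_cases e4 : e = s(v, y)
    · subst e4; simp [h2, n2.symm, e1, e2]
    simp [e1, e2, e3, e4]
  have hsum : (nbrIn (switch G u v x y) w Finset.univ : ℤ) = nbrIn G w Finset.univ := by
    unfold nbrIn
    rw [← Finset.sum_boole, ← Finset.sum_boole]
    simp_rw [hpt]
    rw [Finset.sum_add_distrib, Finset.sum_add_distrib, Finset.sum_sub_distrib,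
      Finset.sum_sub_distrib, key _ _ _ h.uv.ne, key _ _ _ h.xy.ne, key _ _ _ h.ux,
      key _ _ _ h.vy]
    ring
  exact_mod_cast hsum

end Switching

/-! ### Counting regular graphs that contain given edges. -/

section Count

variable {n d : ℕ}

lemma isRegularOfDegree_iff (G : SimpleGraph (Fin n)) [G.LocallyFinite] :
    G.IsRegularOfDegree d ↔ ∀ v, nbrIn G v Finset.univ = d := by
  refine forall_congr' fun v => ?_
  have : G.degree v = nbrIn G v Finset.univ := by
    unfold SimpleGraph.degree nbrIn
    congr 1
    ext w
    simp
  rw [this]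

lemma RegularGraph.nbrIn_univ (G : RegularGraph n d) (v : Fin n) :
    nbrIn G.val v Finset.univ = d := by
  classical
  exact (isRegularOfDegree_iff G.val).1 G.2 v

open Classical in
/-- The regular graphs which contain the edges in `F`. -/
def containing (d : ℕ) (F : Finset (Sym2 (Fin n))) : Finset (RegularGraph n d) :=
  Finset.univ.filter fun G => ∀ e ∈ F, e ∈ G.val.edgeSet

lemma mem_containing {F : Finset (Sym2 (Fin n))} {G : RegularGraph n d} :
    G ∈ containing d F ↔ ∀ e ∈ F, e ∈ G.val.edgeSet := by
  simp [containing]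

open Classical in
/-- The pairs `x`, `y` for which the switching of `uv`, `xy` in `G` respects `F`. -/
def switchings (G : SimpleGraph (Fin n)) (u v : Fin n) (F : Finset (Sym2 (Fin n))) :
    Finset (Fin n × Fin n) :=
  Finset.univ.filter fun p => Switchable G u v p.1 p.2 ∧ s(p.1, p.2) ∉ F

lemma mem_switchings {G : SimpleGraph (Fin n)} {u v : Fin n} {F : Finset (Sym2 (Fin n))}
    {p : Fin n × Fin n} :
    p ∈ switchings G u v F ↔ Switchable G u v p.1 p.2 ∧ s(p.1, p.2) ∉ F := by
  simp [switchings]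

open Classical in
/-- The result of a switching in a regular graph (the graph itself if it is impossible). -/
def RegularGraph.switch (G : RegularGraph n d) (u v x y : Fin n) : RegularGraph n d :=
  ⟨if Switchable G.val u v x y then TwoSampleVoting.switch G.val u v x y else G.val,
    (isRegularOfDegree_iff _).2 fun w => by
      split_ifs with h
      · rw [h.nbrIn_switch, G.nbrIn_univ]
      · exact G.nbrIn_univ w⟩

lemma RegularGraph.val_switch (G : RegularGraph n d) {u v x y : Fin n}
    (h : Switchable G.val u v x y) :
    (G.switch u v x y).val = TwoSampleVoting.switch G.val u v x y :=
  if_pos h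

open Classical in
lemma card_adj_pairs (G : RegularGraph n d) (S : Finset (Fin n)) :
    ((Finset.univ : Finset (Fin n × Fin n)).filter fun p => p.1 ∈ S ∧ G.val.Adj p.1 p.2).card
      = S.card * d := by
  have : ((Finset.univ : Finset (Fin n × Fin n)).filter fun p => p.1 ∈ S ∧ G.val.Adj p.1 p.2)
      = (S.sigma fun v => Finset.univ.filter (G.val.Adj v)).map
        (Equiv.sigmaEquivProd (Fin n) (Fin n)).toEmbedding := by
    ext ⟨a, b⟩
    simp [Equiv.sigmaEquivProd]
  rw [this, Finset.card_map, Finset.card_sigma, Finset.sum_const_nat]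
  exact fun v _ => G.nbrIn_univ v

/-- Of the `n d` oriented edges `(x, y)`, a failing one has `x` equal or adjacent to `u`, or `y`
equal or adjacent to `v`, or lies in `F` (in two orientations). -/
lemma le_card_switchings (G : RegularGraph n d) {u v : Fin n} (huv : G.val.Adj u v)
    (F : Finset (Sym2 (Fin n))) :
    n * d ≤ (switchings G.val u v F).card + 2 * ((d + 1) * d) + 2 * F.card := by
  classical
  set all := (Finset.univ : Finset (Fin n × Fin n)).filter fun p =>
    p.1 ∈ (Finset.univ : Finset (Fin n)) ∧ G.val.Adj p.1 p.2
  set N : Fin n → Finset (Fin n) := fun w => insert w (Finset.univ.filter (G.val.Adj w))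
  have hN : ∀ w, (N w).card ≤ d + 1 := fun w =>
    (Finset.card_insert_le _ _).trans (Nat.succ_le_succ (G.nbrIn_univ w).le)
  set bad : Fin n → Finset (Fin n × Fin n) := fun w =>
    Finset.univ.filter fun p => p.1 ∈ N w ∧ G.val.Adj p.1 p.2
  have hbad : ∀ w, (bad w).card ≤ (d + 1) * d := fun w => by
    rw [card_adj_pairs]
    exact Nat.mul_le_mul_right _ (hN w)
  set FF := (Finset.univ : Finset (Fin n × Fin n)).filter fun p => s(p.1, p.2) ∈ F
  have hFF : FF.card ≤ 2 * F.card := by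
    refine Finset.card_le_mul_card_image_of_maps_to (f := fun p => s(p.1, p.2)) ?_ 2 ?_
    · intro p hp
      exact (Finset.mem_filter.1 hp).2
    · intro e _
      induction e using Sym2.inductionOn with | _ a b
      refine (Finset.card_le_card (t := {(a, b), (b, a)}) ?_).trans Finset.card_le_two
      rintro ⟨p, q⟩ hp
      have := (Finset.mem_filter.1 hp).2
      simpa [Sym2.eq_iff] using this
  have hsub : all ⊆ switchings G.val u v F ∪ bad u ∪ (bad v).map
      (Equiv.prodComm _ _).toEmbedding ∪ FF := by
    rintro ⟨x, y⟩ hp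
    have hxy : G.val.Adj x y := (Finset.mem_filter.1 hp).2.2
    by_contra hnot
    simp only [Finset.mem_union, not_or] at hnot
    obtain ⟨⟨⟨h1, h2⟩, h3⟩, h4⟩ := hnot
    have h2' : ¬ (x = u ∨ G.val.Adj u x) := by
      simpa [bad, N, hxy] using h2
    have h3' : ¬ (y = v ∨ G.val.Adj v y) := by
      simpa [bad, N, hxy.symm] using h3
    have h4' : s(x, y) ∉ F := by simpa [FF] using h4
    push Not at h2' h3'
    exact h1 (mem_switchings.2
      ⟨⟨huv, hxy, h2'.1.symm, h3'.1.symm, h2'.2, h3'.2⟩, h4'⟩)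
  have hall : all.card = n * d := by
    rw [card_adj_pairs]
    simp
  have h1 := Finset.card_le_card hsub
  have h2 := Finset.card_union_le (switchings G.val u v F ∪ bad u ∪ (bad v).map
      (Equiv.prodComm _ _).toEmbedding) FF
  have h3 := Finset.card_union_le (switchings G.val u v F ∪ bad u) ((bad v).map
      (Equiv.prodComm _ _).toEmbedding)
  have h4 := Finset.card_union_le (switchings G.val u v F) (bad u)
  rw [Finset.card_map] at h3
  have := hbad u
  have := hbad v
  omega

/-- Double counting: after the switching, `x` is a neighbour of `u` and `y` one of `v`, which leaves
`d²` choices per resulting graph. The edges of `F` survive since neither removed edge is in `F`. -/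
lemma sum_card_switchings_le {u v : Fin n} {F : Finset (Sym2 (Fin n))}
    (hF : s(u, v) ∉ F) :
    ∑ G ∈ containing d (insert s(u, v) F), (switchings G.val u v F).card
      ≤ (containing d F).card * (d * d) := by
  classical
  have hR : ∑ G ∈ containing d F, ((Finset.univ.filter (G.val.Adj u)) ×ˢ
      (Finset.univ.filter (G.val.Adj v))).card = (containing d F).card * (d * d) := by
    rw [Finset.sum_const_nat]
    intro G _
    rw [Finset.card_product]
    congr 1 <;> exact G.nbrIn_univ _
  rw [← hR, ← Finset.card_sigma, ← Finset.card_sigma]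
  refine Finset.card_le_card_of_injOn
    (fun q => ⟨q.1.switch u v q.2.1 q.2.2, q.2⟩) ?_ ?_
  · rintro ⟨G, x, y⟩ hq
    obtain ⟨h1, h2⟩ := Finset.mem_sigma.1 (Finset.mem_coe.1 hq)
    obtain ⟨hsw, hxy⟩ := mem_switchings.1 h2
    have hc := mem_containing.1 h1
    simp only at hsw hxy hc
    have hE := hsw.edgeSet_switch
    rw [← G.val_switch hsw] at hE
    refine Finset.mem_coe.2 (Finset.mem_sigma.2 ⟨mem_containing.2 ?_,
      Finset.mem_product.2 ⟨Finset.mem_filter.2 ⟨Finset.mem_univ _, ?_⟩,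
        Finset.mem_filter.2 ⟨Finset.mem_univ _, ?_⟩⟩⟩)
    · intro e he
      simp only
      rw [hE]
      refine Or.inl ⟨hc e (Finset.mem_insert_of_mem he), ?_⟩
      rintro (rfl | rfl)
      · exact hF he
      · exact hxy he
    · simp only
      rw [← SimpleGraph.mem_edgeSet, hE]
      exact Or.inr (Or.inl rfl)
    · simp only
      rw [← SimpleGraph.mem_edgeSet, hE]
      exact Or.inr (Or.inr rfl)
  · rintro ⟨G, x, y⟩ hq ⟨G', x', y'⟩ hq' heq
    simp only [Sigma.mk.injEq, heq_eq_eq, Prod.mk.injEq] at heq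
    obtain ⟨hG, rfl, rfl⟩ := heq
    have hs : Switchable G.val u v x y :=
      (mem_switchings.1 (Finset.mem_sigma.1 (Finset.mem_coe.1 hq)).2).1
    have hs' : Switchable G'.val u v x y :=
      (mem_switchings.1 (Finset.mem_sigma.1 (Finset.mem_coe.1 hq')).2).1
    have hval : G = G' := by
      apply Subtype.ext
      rw [← SimpleGraph.edgeSet_inj, hs.edgeSet_eq, hs'.edgeSet_eq, ← G.val_switch hs,
        ← G'.val_switch hs', hG]
    rw [hval]

/-- The probability that a random regular graph contains given edges. -/
lemma card_containing_mul_le {D : ℝ} (hD : 0 ≤ D) {m : ℕ}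
    (hDm : D ≤ n * d - 2 * ((d + 1) * d) - 2 * m) (F : Finset (Sym2 (Fin n)))
    (hF : ∀ e ∈ F, ¬ e.IsDiag) (hm : F.card ≤ m) :
    ((containing d F).card : ℝ) * D ^ F.card
      ≤ ((d : ℝ) * d) ^ F.card * Fintype.card (RegularGraph n d) := by
  classical
  induction F using Finset.induction_on with
  | empty => simpa using Finset.card_le_univ _
  | insert e F he ih =>
    rw [Finset.card_insert_of_notMem he] at hm ⊢
    have ih' := ih (fun e h => hF e (Finset.mem_insert_of_mem h)) (by omega)
    induction e using Sym2.inductionOn with | _ u v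
    have h1 := sum_card_switchings_le (d := d) he
    -- Every graph containing the new edge has at least `D` switchings, so adding an edge to `F`
    -- costs a factor `d² / D`. The bound `m` keeps `D` uniform along the induction.
    have h2 : ((containing d (insert s(u, v) F)).card : ℝ) * D
        ≤ ((∑ G ∈ containing d (insert s(u, v) F), (switchings G.val u v F).card : ℕ) : ℝ) := by
      rw [← nsmul_eq_mul, Nat.cast_sum]
      refine Finset.card_nsmul_le_sum _ _ _ fun G hG => ?_
      have hadj : G.val.Adj u v := mem_containing.1 hG _ (Finset.mem_insert_self _ _)
      have h3 : ((n * d : ℕ) : ℝ) ≤ ((switchings G.val u v F).card + 2 * ((d + 1) * d)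
        + 2 * F.card : ℕ) := by exact_mod_cast le_card_switchings G hadj F
      push_cast at h3
      have h4 : (F.card : ℝ) ≤ m := by exact_mod_cast (by omega : F.card ≤ m)
      linarith
    have h5 : ((containing d (insert s(u, v) F)).card : ℝ) * D
        ≤ (containing d F).card * (d * d) := h2.trans (by exact_mod_cast h1)
    calc ((containing d (insert s(u, v) F)).card : ℝ) * D ^ (F.card + 1)
        = ((containing d (insert s(u, v) F)).card * D) * D ^ F.card := by ring
      _ ≤ ((containing d F).card * (d * d)) * D ^ F.card := by gcongr
      _ = (d * d) * ((containing d F).card * D ^ F.card) := by ring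
      _ ≤ (d * d) * (((d : ℝ) * d) ^ F.card * Fintype.card (RegularGraph n d)) := by gcongr
      _ = _ := by ring

open Classical in
/-- Union bound over the `m`-subsets of `T`. -/
lemma card_many_edges_mul_le (T : Finset (Sym2 (Fin n))) (k m : ℕ) :
    (((Finset.univ : Finset (RegularGraph n d)).filter fun G =>
      k ≤ (T.filter (· ∈ G.val.edgeSet)).card).card) * k.choose m
      ≤ ∑ F ∈ T.powersetCard m, (containing d F).card := by
  -- Pairs `(F, G)` with `F` among the edges of `G` in `T` are counted from the side of `G`.
  have h : ∑ F ∈ T.powersetCard m, (containing d F).card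
      = ∑ G : RegularGraph n d, ((T.filter (· ∈ G.val.edgeSet)).card.choose m) := by
    unfold containing
    simp_rw [Finset.card_filter]
    rw [Finset.sum_comm]
    refine Finset.sum_congr rfl fun G _ => ?_
    rw [← Finset.card_filter, ← Finset.card_filter, ← Finset.card_powersetCard]
    congr 1
    ext F
    simp only [Finset.mem_filter, Finset.mem_powersetCard, Finset.subset_iff]
    constructor
    · rintro ⟨⟨h1, h2⟩, h3⟩
      exact ⟨fun e he => ⟨h1 he, h3 e he⟩, h2⟩
    · rintro ⟨h1, h2⟩
      exact ⟨⟨fun e he => (h1 he).1, h2⟩, fun e he => (h1 he).2⟩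
  rw [h, ← smul_eq_mul]
  refine (Finset.card_nsmul_le_sum _ _ _ fun G hG => ?_).trans
    (Finset.sum_le_sum_of_subset (Finset.subset_univ _))
  exact Nat.choose_le_choose m (Finset.mem_filter.1 hG).2

end Count

/-! ### Neighbour sums as edge counts. -/

section EdgeSets

variable {V : Type*}

open Classical in
/-- The unordered pairs of distinct vertices, one from `S` and one from `B`. -/
def pairsBetween (S B : Finset V) : Finset (Sym2 V) :=
  ((S ×ˢ B).image fun p => s(p.1, p.2)).filter fun e => ¬ e.IsDiag

lemma not_isDiag_of_mem_pairsBetween {S B : Finset V} :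
    ∀ e ∈ pairsBetween S B, ¬ e.IsDiag := by
  classical
  exact fun _ he => (Finset.mem_filter.1 he).2

lemma pairsBetween_mono {S S' B : Finset V} (h : S ⊆ S') :
    pairsBetween S B ⊆ pairsBetween S' B := by
  classical
  intro e he
  obtain ⟨h1, h2⟩ := Finset.mem_filter.1 he
  exact Finset.mem_filter.2
    ⟨Finset.image_subset_image (Finset.product_subset_product_left h) h1, h2⟩

lemma card_pairsBetween_le (S B : Finset V) :
    (pairsBetween S B).card ≤ S.card * B.card := by
  classical
  exact (Finset.card_filter_le _ _).trans
    (Finset.card_image_le.trans (Finset.card_product _ _).le)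

/-- The factor `2` offsets the one in `sum_nbrIn_self_le`, where each edge inside `B` is seen from
both ends; thus `inner` has the same main term as `cross`. -/
lemma two_mul_card_pairsBetween_self_le (B : Finset V) :
    2 * (pairsBetween B B).card ≤ B.card * B.card := by
  classical
  have h : pairsBetween B B ⊆ B.offDiag.image fun p => s(p.1, p.2) := by
    intro e he
    obtain ⟨h1, h2⟩ := Finset.mem_filter.1 he
    obtain ⟨p, hp, rfl⟩ := Finset.mem_image.1 h1
    rw [Sym2.mk_isDiag_iff] at h2
    rw [Finset.mem_product] at hp
    exact Finset.mem_image.2 ⟨p, Finset.mem_offDiag.2 ⟨hp.1, hp.2, h2⟩, rfl⟩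
  have h2 := Sym2.two_mul_card_image_offDiag B
  have h3 := Finset.card_le_card h
  have h4 := Finset.offDiag_card B
  have h5 : (B.offDiag.image fun p => s(p.1, p.2)) = B.offDiag.image Sym2.mk.uncurry := rfl
  rw [h5] at h3
  omega

open Classical in
/-- The edges of `G` between `S` and `B`. -/
def edgesBetween (G : SimpleGraph V) (S B : Finset V) : Finset (Sym2 V) :=
  (pairsBetween S B).filter (· ∈ G.edgeSet)

open Classical in
lemma sum_nbrIn_eq (G : SimpleGraph V) (S B : Finset V) :
    ∑ v ∈ S, nbrIn G v B = ((S ×ˢ B).filter fun p => G.Adj p.1 p.2).card := by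
  unfold nbrIn
  simp_rw [Finset.card_filter]
  rw [Finset.sum_product]

lemma mk_mem_edgesBetween {G : SimpleGraph V} {S B : Finset V} {p : V × V}
    (h : p.1 ∈ S ∧ p.2 ∈ B) (hp : G.Adj p.1 p.2) : s(p.1, p.2) ∈ edgesBetween G S B := by
  classical
  refine Finset.mem_filter.2 ⟨Finset.mem_filter.2 ⟨Finset.mem_image.2
    ⟨p, Finset.mem_product.2 h, rfl⟩, ?_⟩, hp⟩
  rw [Sym2.mk_isDiag_iff]
  exact hp.ne

lemma sum_nbrIn_le_of_disjoint (G : SimpleGraph V) {S B : Finset V} (h : Disjoint S B) :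
    ∑ v ∈ S, nbrIn G v B ≤ (edgesBetween G S B).card := by
  classical
  rw [sum_nbrIn_eq]
  refine Finset.card_le_card_of_injOn (fun p => s(p.1, p.2)) ?_ ?_
  · intro p hp
    obtain ⟨h1, h2⟩ := Finset.mem_filter.1 (Finset.mem_coe.1 hp)
    exact mk_mem_edgesBetween (Finset.mem_product.1 h1) h2
  · rintro ⟨a, b⟩ hp ⟨a', b'⟩ hp' heq
    have h1 := Finset.mem_product.1 (Finset.mem_filter.1 (Finset.mem_coe.1 hp)).1
    have h2 := Finset.mem_product.1 (Finset.mem_filter.1 (Finset.mem_coe.1 hp')).1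
    simp only [Sym2.eq_iff] at heq
    rcases heq with ⟨rfl, rfl⟩ | ⟨rfl, rfl⟩
    · rfl
    · exact absurd h2.2 (Finset.disjoint_left.1 h h1.1)

lemma sum_nbrIn_self_le (G : SimpleGraph V) (B : Finset V) :
    ∑ v ∈ B, nbrIn G v B ≤ 2 * (edgesBetween G B B).card := by
  classical
  rw [sum_nbrIn_eq]
  refine Finset.card_le_mul_card_image_of_maps_to (f := fun p => s(p.1, p.2)) ?_ 2 ?_
  · intro p hp
    obtain ⟨h1, h2⟩ := Finset.mem_filter.1 hp
    exact mk_mem_edgesBetween (Finset.mem_product.1 h1) h2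
  · intro e _
    induction e using Sym2.inductionOn with | _ a b
    refine (Finset.card_le_card (t := {(a, b), (b, a)}) ?_).trans Finset.card_le_two
    rintro ⟨p, q⟩ hp
    have := (Finset.mem_filter.1 hp).2
    simpa [Sym2.eq_iff] using this

end EdgeSets

/-! ### Tail bounds for the number of edges in a set of pairs. -/

section Tails

variable {n d : ℕ}

open Classical in
/-- The regular graphs with at least `k` edges in `T`. -/
def manyEdges (d : ℕ) (T : Finset (Sym2 (Fin n))) (k : ℕ) : Finset (RegularGraph n d) :=
  Finset.univ.filter fun G => k ≤ (T.filter (· ∈ G.val.edgeSet)).card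

lemma mem_manyEdges {S B : Finset (Fin n)} {k : ℕ} {G : RegularGraph n d} :
    G ∈ manyEdges d (pairsBetween S B) k ↔ k ≤ (edgesBetween G.val S B).card := by
  simp [manyEdges, edgesBetween]

lemma card_manyEdges_mul_le {D : ℝ} (hD : 0 < D) {m : ℕ}
    (hDm : D ≤ n * d - 2 * ((d + 1) * d) - 2 * m) (T : Finset (Sym2 (Fin n)))
    (hT : ∀ e ∈ T, ¬ e.IsDiag) (k : ℕ) :
    ((manyEdges d T k).card : ℝ) * k.choose m
      ≤ (T.card.choose m) * ((d : ℝ) * d / D) ^ m * Fintype.card (RegularGraph n d) := by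
  classical
  have h1 : ((manyEdges d T k).card : ℝ) * k.choose m
      ≤ ((∑ F ∈ T.powersetCard m, (containing d F).card : ℕ) : ℝ) := by
    exact_mod_cast card_many_edges_mul_le T k m
  refine h1.trans ?_
  rw [Nat.cast_sum, mul_assoc, ← Finset.card_powersetCard, ← nsmul_eq_mul]
  refine Finset.sum_le_card_nsmul _ _ _ fun F hF => ?_
  obtain ⟨hFT, hFm⟩ := Finset.mem_powersetCard.1 hF
  have h2 := card_containing_mul_le hD.le hDm F (fun e he => hT e (hFT he)) hFm.le
  rw [hFm] at h2
  rw [div_pow, div_mul_eq_mul_div, le_div_iff₀ (by positivity)]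
  exact h2

/-- The quotient of the bases is `1 - 14 m / (μ + 19 m) ≤ 1 - 7 m / P ≤ exp (-(7 m / P))`, and `m² /
P ≥ N`. -/
lemma pow_le_exp_mul_pow {μ P N : ℝ} {m : ℕ} (hP : 0 < P) (hμ : 0 ≤ μ) (hμP : μ ≤ P)
    (hm : 19 * (m : ℝ) ≤ P) (hN : N * P ≤ m * m) :
    (μ + 5 * m) ^ m ≤ Real.exp (-(7 * N)) * (μ + 19 * m) ^ m := by
  have hm0 : (0 : ℝ) ≤ m := Nat.cast_nonneg _
  have h6 : μ + 5 * m ≤ Real.exp (-(7 * m / P)) * (μ + 19 * m) := by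
    have e1 := Real.add_one_le_exp (-(7 * m / P))
    have e2 : (-(7 * m / P) + 1) * (μ + 19 * m) ≤ Real.exp (-(7 * m / P)) * (μ + 19 * m) := by
      gcongr
    refine le_trans ?_ e2
    have e3 : 7 * m / P * (μ + 19 * m) ≤ 7 * m / P * (2 * P) := by
      gcongr
      linarith
    have e4 : 7 * m / P * (2 * P) = 14 * (m : ℝ) := by
      field_simp
      ring
    linarith
  refine (pow_le_pow_left₀ (by positivity) h6 m).trans ?_
  rw [mul_pow, ← Real.exp_nat_mul]
  gcongr
  have e2 : 7 * N ≤ m * (7 * m / P) := by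
    rw [mul_div_assoc', le_div_iff₀ hP]
    linarith
  linarith

/-- With subsets of size `m ≈ √d n`, the bound is `((μ + 5 m) / (μ + 19 m)) ^ m`, where `μ` is the
expected count suggested by density. The excess `20 m` is chosen so that `exp (-(7 n))` beats the `4
^ n` pairs of vertex sets. -/
lemma card_manyEdges_large_le (hd : 10000 ≤ d) (hdn : d * d ≤ n) {m : ℕ}
    (hm : m = ⌈Real.sqrt d * n⌉₊) (T : Finset (Sym2 (Fin n))) (hT : ∀ e ∈ T, ¬ e.IsDiag)
    (hTn : T.card ≤ n * n) :
    ((manyEdges d T (⌈(d * T.card / n : ℝ)⌉₊ + 20 * m)).card : ℝ)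
      ≤ Real.exp (-(7 * n)) * Fintype.card (RegularGraph n d) := by
  have hdR : (10000 : ℝ) ≤ d := by exact_mod_cast hd
  have hdnR : (d : ℝ) * d ≤ n := by exact_mod_cast hdn
  have hn0 : (0 : ℝ) < n := by nlinarith
  have hs : (100 : ℝ) ≤ Real.sqrt d := by
    rw [show (100 : ℝ) = Real.sqrt 10000 by
      rw [show (10000 : ℝ) = 100 ^ 2 by norm_num, Real.sqrt_sq (by norm_num)]]
    exact Real.sqrt_le_sqrt hdR
  have hss : Real.sqrt d * Real.sqrt d = d := Real.mul_self_sqrt (by linarith)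
  have hm1 : Real.sqrt d * n ≤ m := by rw [hm]; exact Nat.le_ceil _
  have hm2 : (m : ℝ) ≤ 2 * (Real.sqrt d * n) := by
    have := Nat.ceil_lt_add_one (a := Real.sqrt d * n) (by positivity)
    rw [← hm] at this
    nlinarith
  have hmd : 50 * (m : ℝ) ≤ n * d := by
    calc 50 * (m : ℝ) ≤ 100 * (Real.sqrt d * n) := by linarith
      _ ≤ Real.sqrt d * (Real.sqrt d * n) := by gcongr
      _ = n * d := by rw [← mul_assoc, hss, mul_comm]
  have hm0 : (0 : ℝ) < m := lt_of_lt_of_le (by positivity) hm1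
  -- Here `d² ≤ n` enters: the switchings lost near `u` and `v` are negligible against `m`.
  have hdd : 2 * (((d : ℝ) + 1) * d) ≤ m / 5 := by nlinarith
  set D : ℝ := n * d - 2 * ((d + 1) * d) - 2 * m with hD
  have hDh : n * d / 2 ≤ D := by rw [hD]; linarith
  have hnd : 0 < (n : ℝ) * d := by nlinarith
  have hD0 : 0 < D := by linarith
  set μ : ℝ := d * T.card / n with hμ
  have hμ0 : 0 ≤ μ := by positivity
  have hμn : μ ≤ n * d := by
    rw [hμ, div_le_iff₀ hn0]
    have : (T.card : ℝ) ≤ n * n := by exact_mod_cast hTn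
    calc (d : ℝ) * T.card ≤ d * (n * n) := by gcongr
      _ = n * d * n := by ring
  set k := ⌈μ⌉₊ + 20 * m with hk
  have h1 := card_manyEdges_mul_le hD0 hD.le T hT k
  set N : ℝ := (Fintype.card (RegularGraph n d) : ℝ) with hN
  have hN0 : 0 ≤ N := Nat.cast_nonneg _
  set M : ℝ := ((manyEdges d T k).card : ℝ) with hM
  have hM0 : 0 ≤ M := Nat.cast_nonneg _
  have hfac : (0 : ℝ) < m.factorial := by exact_mod_cast m.factorial_pos
  have h2 : (μ + 19 * m) ^ m / m.factorial ≤ (k.choose m : ℝ) := by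
    have h3 : ((k + 1 - m : ℕ) : ℝ) ^ m ≤ m.factorial * k.choose m := by
      have := Nat.pow_sub_le_descFactorial k m
      rw [Nat.descFactorial_eq_factorial_mul_choose] at this
      exact_mod_cast this
    have h4 : μ + 19 * m ≤ ((k + 1 - m : ℕ) : ℝ) := by
      rw [Nat.cast_sub (by omega), hk]
      push_cast
      linarith [Nat.le_ceil μ]
    rw [div_le_iff₀ hfac, mul_comm (k.choose m : ℝ)]
    exact (pow_le_pow_left₀ (by positivity) h4 m).trans h3
  have h3 : (T.card.choose m : ℝ) ≤ (T.card : ℝ) ^ m / m.factorial := Nat.choose_le_pow_div _ _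
  have h4 : (T.card : ℝ) * (d * d / D) ≤ μ + 5 * m := by
    have : (T.card : ℝ) * (d * d / D) = μ * (n * d) / D := by
      rw [hμ]; field_simp
    rw [this, div_le_iff₀ hD0]
    have e1 : μ * (2 * ((d + 1) * d) + 2 * m) ≤ (n * d) * (m / 5 + 2 * m) := by gcongr
    have e2 : 5 * m * (n * d / 2) ≤ 5 * m * D := by gcongr
    have e3 : (μ + 5 * m) * D = μ * (n * d) - μ * (2 * ((d + 1) * d) + 2 * m) + 5 * m * D := by
      rw [hD]; ring
    have e4 : 0 ≤ m * (n * d : ℝ) := by positivity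
    rw [e3]
    nlinarith
  have h5 : M * (μ + 19 * m) ^ m ≤ (μ + 5 * m) ^ m * N := by
    have e1 : M * ((μ + 19 * m) ^ m / m.factorial)
        ≤ (T.card : ℝ) ^ m / m.factorial * ((d : ℝ) * d / D) ^ m * N :=
      (mul_le_mul_of_nonneg_left h2 hM0).trans (h1.trans (by gcongr))
    have e2 : M * (μ + 19 * m) ^ m ≤ ((T.card : ℝ) * (d * d / D)) ^ m * N := by
      rw [mul_pow]
      have := mul_le_mul_of_nonneg_right e1 hfac.le
      have e3 : M * ((μ + 19 * m) ^ m / m.factorial) * m.factorial = M * (μ + 19 * m) ^ m := by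
        field_simp
      have e4 : (T.card : ℝ) ^ m / m.factorial * ((d : ℝ) * d / D) ^ m * N * m.factorial
          = (T.card : ℝ) ^ m * ((d : ℝ) * d / D) ^ m * N := by
        field_simp
      rwa [e3, e4] at this
    refine e2.trans ?_
    gcongr
  have h6 : (n : ℝ) * (n * d) ≤ m * m := by
    calc (n : ℝ) * (n * d) = n * (n * (Real.sqrt d * Real.sqrt d)) := by rw [hss]
      _ = (Real.sqrt d * n) * (Real.sqrt d * n) := by ring
      _ ≤ m * m := by gcongr
  have h8 := pow_le_exp_mul_pow hnd hμ0 hμn (by linarith) h6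
  have h9 : 0 < (μ + 19 * m) ^ m := by positivity
  have h10 : M * (μ + 19 * m) ^ m ≤ Real.exp (-(7 * n)) * N * (μ + 19 * m) ^ m := by
    refine h5.trans ((mul_le_mul_of_nonneg_right h8 hN0).trans (le_of_eq ?_))
    ring
  exact le_of_mul_le_mul_right h10 h9

lemma inv_factorial_le (m : ℕ) (hm : 0 < m) :
    (1 : ℝ) / m.factorial ≤ (Real.exp 1 / m) ^ m := by
  have h := Real.pow_div_factorial_le_exp (x := (m : ℝ)) (Nat.cast_nonneg _) m
  have hm' : (0 : ℝ) < (m : ℝ) ^ m := by positivity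
  rw [div_pow, ← Real.exp_nat_mul, mul_one, le_div_iff₀ hm']
  rwa [one_div_mul_eq_div]

/-- A first-moment bound with `k = m`: since `m! ≥ (m / e) ^ m`, the base is at most `8 b² · e / (d
b / 16) · 2 d / n = 256 e b / n`. -/
lemma card_manyEdges_small_le (hd : 10000 ≤ d) (hdn : d * d ≤ n) {b : ℕ} (hb : 0 < b)
    (hbn : b ≤ n) (T : Finset (Sym2 (Fin n))) (hT : ∀ e ∈ T, ¬ e.IsDiag)
    (hTb : T.card ≤ 8 * b * b) :
    ((manyEdges d T ⌈(d * b / 16 : ℝ)⌉₊).card : ℝ)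
      ≤ (700 * (b / n : ℝ)) ^ ⌈(d * b / 16 : ℝ)⌉₊ * Fintype.card (RegularGraph n d) := by
  have hdR : (10000 : ℝ) ≤ d := by exact_mod_cast hd
  have hdnR : (d : ℝ) * d ≤ n := by exact_mod_cast hdn
  have hbR : (1 : ℝ) ≤ b := by exact_mod_cast hb
  have hbnR : (b : ℝ) ≤ n := by exact_mod_cast hbn
  have hn0 : (0 : ℝ) < n := by nlinarith
  set m := ⌈(d * b / 16 : ℝ)⌉₊ with hm
  have hm1 : (d * b / 16 : ℝ) ≤ m := Nat.le_ceil _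
  have hm2 : (m : ℝ) ≤ d * b / 16 + 1 := (Nat.ceil_lt_add_one (by positivity)).le
  have hm0 : 0 < m := Nat.ceil_pos.2 (by positivity)
  have hm0R : (0 : ℝ) < m := by exact_mod_cast hm0
  set D : ℝ := n * d - 2 * ((d + 1) * d) - 2 * m with hD
  have hnd : 0 < (n : ℝ) * d := by nlinarith
  have hDh : n * d / 2 ≤ D := by
    have : (d : ℝ) * b ≤ d * n := by gcongr
    have : 10000 * (n : ℝ) ≤ n * d := by nlinarith
    rw [hD]
    nlinarith
  have hD0 : 0 < D := by linarith
  have h1 := card_manyEdges_mul_le hD0 hD.le T hT m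
  rw [Nat.choose_self, Nat.cast_one, mul_one] at h1
  refine h1.trans ?_
  refine mul_le_mul_of_nonneg_right ?_ (Nat.cast_nonneg _)
  have h2 : (T.card.choose m : ℝ) ≤ (T.card * (Real.exp 1 / m)) ^ m := by
    refine (Nat.choose_le_pow_div _ _).trans ?_
    rw [mul_pow, div_eq_mul_one_div]
    gcongr
    exact inv_factorial_le m hm0
  have h3 : (T.card * (Real.exp 1 / m)) * ((d : ℝ) * d / D) ≤ 700 * (b / n) := by
    have e1 : (T.card : ℝ) ≤ 8 * b * b := by exact_mod_cast hTb
    have e2 : Real.exp 1 / m ≤ 2.72 / (d * b / 16) := by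
      gcongr
      exact (Real.exp_one_lt_d9.trans (by norm_num)).le
    have e3 : (d : ℝ) * d / D ≤ d * d / (n * d / 2) := by gcongr
    calc (T.card * (Real.exp 1 / m)) * ((d : ℝ) * d / D)
        ≤ (8 * b * b * (2.72 / (d * b / 16))) * (d * d / (n * d / 2)) := by gcongr
      _ = 696.32 * (b / n) := by field_simp; norm_num
      _ ≤ 700 * (b / n) := by gcongr; norm_num
  calc (T.card.choose m : ℝ) * ((d : ℝ) * d / D) ^ m
      ≤ (T.card * (Real.exp 1 / m)) ^ m * ((d : ℝ) * d / D) ^ m := by gcongr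
    _ = ((T.card * (Real.exp 1 / m)) * ((d : ℝ) * d / D)) ^ m := (mul_pow _ _ _).symm
    _ ≤ (700 * (b / n)) ^ m := by gcongr

end Tails

/-! ### Random regular graphs are well mixed. -/

section UnionBound

variable {n d : ℕ}

/-- The constant `80` is `20`, doubled for rounding up `√d n` and again because inner edges count
twice; the latter also explains `d b / 16` against `d b / 8` in `WellMixed`. -/
lemma wellMixed_of_few_edges (hd : 10000 ≤ d) (hn : 1 ≤ n) (G : RegularGraph n d)
    (h1 : ∀ S B : Finset (Fin n), G ∉ manyEdges d (pairsBetween S B)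
      (⌈(d * (pairsBetween S B).card / n : ℝ)⌉₊ + 20 * ⌈Real.sqrt d * n⌉₊))
    (h2 : ∀ b : ℕ, 0 < b → b ≤ n / 10 ^ 7 → ∀ S B : Finset (Fin n), S.card = 8 * b →
      B.card = b → G ∉ manyEdges d (pairsBetween S B) ⌈(d * b / 16 : ℝ)⌉₊) :
    WellMixed G.val d 80 (1 / 10 ^ 7) := by
  have hdR : (10000 : ℝ) ≤ d := by exact_mod_cast hd
  have hnR : (1 : ℝ) ≤ n := by exact_mod_cast hn
  have hs : 1 ≤ Real.sqrt d := Real.one_le_sqrt.2 (by linarith)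
  have hs1 : 1 ≤ Real.sqrt d * n := by nlinarith
  have hcard : ∀ S B : Finset (Fin n), ((edgesBetween G.val S B).card : ℝ)
      ≤ d * (pairsBetween S B).card / n + 40 * (Real.sqrt d * n) := by
    intro S B
    have h := h1 S B
    rw [mem_manyEdges, not_le] at h
    have h3 : ((edgesBetween G.val S B).card : ℝ) + 1
        ≤ ⌈(d * (pairsBetween S B).card / n : ℝ)⌉₊ + 20 * ⌈Real.sqrt d * n⌉₊ := by
      exact_mod_cast h
    have h4 := Nat.ceil_lt_add_one (a := (d * (pairsBetween S B).card / n : ℝ)) (by positivity)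
    have h5 := Nat.ceil_lt_add_one (a := Real.sqrt d * n) (by positivity)
    linarith
  have hsmall : ∀ S B : Finset (Fin n), (B.card : ℝ) ≤ 1 / 10 ^ 7 * Fintype.card (Fin n) →
      S.card ≤ 8 * B.card → ((edgesBetween G.val S B).card : ℝ) ≤ d * B.card / 16 := by
    intro S B hB hS
    rw [Fintype.card_fin] at hB
    rcases Nat.eq_zero_or_pos B.card with hb | hb
    · have h3 : (edgesBetween G.val S B).card ≤ S.card * B.card := by
        classical
        exact (Finset.card_filter_le _ _).trans (card_pairsBetween_le S B)
      rw [hb, mul_zero] at h3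
      rw [hb, Nat.le_zero.1 h3]
      simp
    · have hb' : B.card ≤ n / 10 ^ 7 := by
        rw [Nat.le_div_iff_mul_le (by norm_num)]
        have : (B.card : ℝ) * 10 ^ 7 ≤ n := by linarith
        exact_mod_cast this
      -- Enlarging `S` only adds edges, so the union bound needs only sets of exactly `8 b`
      -- vertices.
      obtain ⟨S', hSS', hS'⟩ := Finset.exists_superset_card_eq hS (by
        rw [Fintype.card_fin]
        omega)
      have h := h2 B.card hb hb' S' B hS' rfl
      rw [mem_manyEdges, not_le, Nat.lt_ceil] at h
      have h3 : (edgesBetween G.val S B).card ≤ (edgesBetween G.val S' B).card := by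
        classical
        exact Finset.card_le_card (Finset.filter_subset_filter _ (pairsBetween_mono hSS'))
      exact (Nat.cast_le.2 h3).trans h.le
  refine ⟨G.nbrIn_univ, ?_, ?_, ?_, ?_⟩
  · intro S B hSB
    have h3 : (∑ v ∈ S, (nbrIn G.val v B : ℝ)) ≤ (edgesBetween G.val S B).card := by
      exact_mod_cast sum_nbrIn_le_of_disjoint G.val hSB
    have h4 : ((pairsBetween S B).card : ℝ) ≤ S.card * B.card := by
      exact_mod_cast card_pairsBetween_le S B
    have h5 : (d * (pairsBetween S B).card / n : ℝ) ≤ d * (S.card * B.card) / n := by gcongr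
    have h6 : (d * (S.card * B.card) / n : ℝ) = d * (B.card / n) * S.card := by ring
    rw [Fintype.card_fin]
    have := hcard S B
    linarith
  · intro B
    have h3 : (∑ v ∈ B, (nbrIn G.val v B : ℝ)) ≤ 2 * (edgesBetween G.val B B).card := by
      exact_mod_cast sum_nbrIn_self_le G.val B
    have h4 : 2 * ((pairsBetween B B).card : ℝ) ≤ B.card * B.card := by
      exact_mod_cast two_mul_card_pairsBetween_self_le B
    have h5 : (d * (2 * (pairsBetween B B).card) / n : ℝ) ≤ d * (B.card * B.card) / n := by gcongr
    have h6 : (d * (B.card * B.card) / n : ℝ) = d * (B.card / n) * B.card := by ring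
    have h7 : (d * (2 * (pairsBetween B B).card) / n : ℝ)
      = 2 * (d * (pairsBetween B B).card / n) := by ring
    rw [Fintype.card_fin]
    have := hcard B B
    linarith
  · intro S B hSB hB hS
    have h3 : (∑ v ∈ S, (nbrIn G.val v B : ℝ)) ≤ (edgesBetween G.val S B).card := by
      exact_mod_cast sum_nbrIn_le_of_disjoint G.val hSB
    have h4 := hsmall S B hB hS
    have : (0 : ℝ) ≤ d * B.card := by positivity
    linarith
  · intro B hB
    have h3 : (∑ v ∈ B, (nbrIn G.val v B : ℝ)) ≤ 2 * (edgesBetween G.val B B).card := by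
      exact_mod_cast sum_nbrIn_self_le G.val B
    have h4 := hsmall B B hB (by omega)
    linarith

lemma choose_le_exp_div_pow {b : ℕ} (hb : 0 < b) :
    (n.choose b : ℝ) ≤ (Real.exp 1 / (b / n : ℝ)) ^ b := by
  refine (Nat.choose_le_pow_div _ _).trans ?_
  rw [div_eq_mul_one_div]
  calc (n : ℝ) ^ b * (1 / b.factorial) ≤ (n : ℝ) ^ b * (Real.exp 1 / b) ^ b := by
        gcongr
        exact inv_factorial_le b hb
    _ = (Real.exp 1 / (b / n : ℝ)) ^ b := by
        rw [← mul_pow]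
        congr 1
        rw [div_div_eq_mul_div]
        ring

/-- With `x = b / n`, the binomials cost `(e / x) ^ (9 b)` while the tail gains `(700 x) ^ (20 b)`.
Of the remaining `x ^ 11` per unit of `b`, ten powers beat the constants and one yields the factor
`1 / n`. -/
lemma choose_mul_choose_mul_pow_le {b m : ℕ} (hb : 0 < b) (hbn : b ≤ n / 10 ^ 7)
    (hm : 20 * b ≤ m) :
    (n.choose (8 * b) : ℝ) * n.choose b * (700 * (b / n : ℝ)) ^ m ≤ (1 / 2) ^ b / n := by
  have hbR : (0 : ℝ) < b := by exact_mod_cast hb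
  have hbn' : (b : ℝ) * 10 ^ 7 ≤ n := by
    rw [Nat.le_div_iff_mul_le (by norm_num)] at hbn
    exact_mod_cast hbn
  have hn0 : (0 : ℝ) < n := lt_of_lt_of_le (by positivity) hbn'
  set x : ℝ := b / n with hx
  have hx0 : 0 < x := by positivity
  have hx7 : x ≤ 1 / 10 ^ 7 := by
    rw [hx, div_le_div_iff₀ hn0 (by positivity)]
    linarith
  have h1 : (n.choose b : ℝ) ≤ (Real.exp 1 / x) ^ b := choose_le_exp_div_pow hb
  have h2 : (n.choose (8 * b) : ℝ) ≤ (Real.exp 1 / x) ^ (8 * b) := by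
    refine (choose_le_exp_div_pow (by omega)).trans ?_
    rw [hx]
    gcongr
    omega
  have h3 : (700 * x) ^ m ≤ (700 * x) ^ (20 * b) :=
    pow_le_pow_of_le_one (by positivity) (by linarith) hm
  have hconst : Real.exp 1 ^ 9 * 700 ^ 20 * x ^ 10 ≤ 1 / 4 := by
    have he : Real.exp 1 ≤ 3 := Real.exp_one_lt_three.le
    calc Real.exp 1 ^ 9 * 700 ^ 20 * x ^ 10 ≤ 3 ^ 9 * 700 ^ 20 * (1 / 10 ^ 7) ^ 10 := by gcongr
      _ ≤ 1 / 4 := by norm_num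
  calc (n.choose (8 * b) : ℝ) * n.choose b * (700 * x) ^ m
      ≤ (Real.exp 1 / x) ^ (8 * b) * (Real.exp 1 / x) ^ b * (700 * x) ^ (20 * b) := by gcongr
    _ = (((Real.exp 1 / x) ^ 9) * (700 * x) ^ 20) ^ b := by
        rw [mul_pow ((Real.exp 1 / x) ^ 9), ← pow_mul, ← pow_mul, ← pow_add,
          show 8 * b + b = 9 * b by ring]
    _ = ((Real.exp 1 ^ 9 * 700 ^ 20 * x ^ 10) * x) ^ b := by
        congr 1
        field_simp
    _ ≤ (1 / 4 * x) ^ b := by gcongr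
    _ = (1 / 4) ^ b * x ^ b := mul_pow _ _ _
    _ ≤ (1 / 4) ^ b * x := by
        gcongr
        exact pow_le_of_le_one hx0.le (by linarith) hb.ne'
    _ = (b * (1 / 4) ^ b) / n := by rw [hx]; ring
    _ ≤ (1 / 2) ^ b / n := by
        gcongr
        have h4 : (b : ℝ) ≤ 2 ^ b := by exact_mod_cast Nat.lt_two_pow_self.le
        calc (b : ℝ) * (1 / 4) ^ b ≤ 2 ^ b * (1 / 4) ^ b := by gcongr
          _ = (1 / 2) ^ b := by rw [← mul_pow]; norm_num

open Classical in
/-- A random regular graph is well mixed with high probability. -/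
lemma card_not_wellMixed_le (hd : 10000 ≤ d) (hdn : d * d ≤ n) :
    (((Finset.univ : Finset (RegularGraph n d)).filter fun G =>
      ¬ WellMixed G.val d 80 (1 / 10 ^ 7)).card : ℝ)
      ≤ 3 / n * Fintype.card (RegularGraph n d) := by
  have hn : 1 ≤ n := by nlinarith
  have hnR : (1 : ℝ) ≤ n := by exact_mod_cast hn
  set N : ℝ := (Fintype.card (RegularGraph n d) : ℝ) with hN
  have hN0 : 0 ≤ N := Nat.cast_nonneg _
  set U₁ : Finset (RegularGraph n d) :=
    (Finset.univ : Finset (Finset (Fin n) × Finset (Fin n))).biUnion fun p =>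
      manyEdges d (pairsBetween p.1 p.2)
        (⌈(d * (pairsBetween p.1 p.2).card / n : ℝ)⌉₊ + 20 * ⌈Real.sqrt d * n⌉₊) with hU₁
  set P : ℕ → Finset (Finset (Fin n) × Finset (Fin n)) := fun b =>
    (Finset.univ : Finset (Fin n)).powersetCard (8 * b) ×ˢ
      (Finset.univ : Finset (Fin n)).powersetCard b with hP
  set U₂ : Finset (RegularGraph n d) := (Finset.Icc 1 (n / 10 ^ 7)).biUnion fun b =>
    (P b).biUnion fun p => manyEdges d (pairsBetween p.1 p.2) ⌈(d * b / 16 : ℝ)⌉₊ with hU₂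
  have hsub : ((Finset.univ : Finset (RegularGraph n d)).filter fun G =>
      ¬ WellMixed G.val d 80 (1 / 10 ^ 7)) ⊆ U₁ ∪ U₂ := by
    intro G hG
    by_contra hnot
    rw [Finset.mem_union, not_or] at hnot
    refine (Finset.mem_filter.1 hG).2 (wellMixed_of_few_edges hd hn G ?_ ?_)
    · intro S B hmem
      exact hnot.1 (Finset.mem_biUnion.2 ⟨(S, B), Finset.mem_univ _, hmem⟩)
    · intro b hb hbn S B hS hB hmem
      exact hnot.2 (Finset.mem_biUnion.2 ⟨b, Finset.mem_Icc.2 ⟨hb, hbn⟩,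
        Finset.mem_biUnion.2 ⟨(S, B), Finset.mem_product.2
          ⟨Finset.mem_powersetCard_univ.2 hS, Finset.mem_powersetCard_univ.2 hB⟩, hmem⟩⟩)
  have h1 : (U₁.card : ℝ) ≤ 1 / n * N := by
    have e1 : (U₁.card : ℝ) ≤ (4 : ℝ) ^ n * (Real.exp (-(7 * n)) * N) := by
      have e2 : (U₁.card : ℝ) ≤ ((∑ p : Finset (Fin n) × Finset (Fin n),
          (manyEdges d (pairsBetween p.1 p.2) (⌈(d * (pairsBetween p.1 p.2).card / n : ℝ)⌉₊
            + 20 * ⌈Real.sqrt d * n⌉₊)).card : ℕ) : ℝ) := by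
        exact Nat.cast_le.2 Finset.card_biUnion_le
      refine e2.trans ?_
      rw [Nat.cast_sum]
      have e3 := Finset.sum_le_card_nsmul
        (Finset.univ : Finset (Finset (Fin n) × Finset (Fin n)))
        (fun p => ((manyEdges d (pairsBetween p.1 p.2) (⌈(d * (pairsBetween p.1 p.2).card / n : ℝ)⌉₊
            + 20 * ⌈Real.sqrt d * n⌉₊)).card : ℝ)) (Real.exp (-(7 * n)) * N) fun p _ =>
          card_manyEdges_large_le hd hdn rfl _ not_isDiag_of_mem_pairsBetween
            ((card_pairsBetween_le _ _).trans (Nat.mul_le_mul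
              ((Finset.card_le_univ _).trans (Fintype.card_fin n).le)
              ((Finset.card_le_univ _).trans (Fintype.card_fin n).le)))
      refine e3.trans (le_of_eq ?_)
      rw [nsmul_eq_mul, Finset.card_univ, Fintype.card_prod, Fintype.card_finset, Fintype.card_fin,
        ← mul_pow]
      norm_num
    refine e1.trans ?_
    rw [← mul_assoc]
    refine mul_le_mul_of_nonneg_right ?_ hN0
    have e4 : (4 : ℝ) ≤ Real.exp 2 := by
      have := Real.add_one_le_exp (1 : ℝ)
      have e : Real.exp 2 = Real.exp 1 * Real.exp 1 := by rw [← Real.exp_add]; norm_num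
      rw [e]
      nlinarith
    calc (4 : ℝ) ^ n * Real.exp (-(7 * n)) ≤ Real.exp 2 ^ n * Real.exp (-(7 * n)) := by gcongr
      _ = Real.exp (-(5 * n)) := by
        rw [← Real.exp_nat_mul, ← Real.exp_add]
        ring_nf
      _ ≤ 1 / n := by
        rw [Real.exp_neg, ← one_div]
        refine one_div_le_one_div_of_le (by linarith) ?_
        have := Real.add_one_le_exp (5 * n : ℝ)
        linarith
  have h2 : (U₂.card : ℝ) ≤ 2 / n * N := by
    have e2 : (U₂.card : ℝ) ≤ ((∑ b ∈ Finset.Icc 1 (n / 10 ^ 7), ∑ p ∈ P b,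
        (manyEdges d (pairsBetween p.1 p.2) ⌈(d * b / 16 : ℝ)⌉₊).card : ℕ) : ℝ) := by
      exact Nat.cast_le.2 <| Finset.card_biUnion_le.trans
        (Finset.sum_le_sum fun b _ => Finset.card_biUnion_le)
    have e3 : ∀ b ∈ Finset.Icc 1 (n / 10 ^ 7), (((∑ p ∈ P b,
        (manyEdges d (pairsBetween p.1 p.2) ⌈(d * b / 16 : ℝ)⌉₊).card : ℕ)) : ℝ)
        ≤ (1 / 2) ^ b * (N / n) := by
      intro b hb
      obtain ⟨hb1, hb2⟩ := Finset.mem_Icc.1 hb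
      have hm : 20 * b ≤ ⌈(d * b / 16 : ℝ)⌉₊ := by
        have : ((20 * b : ℕ) : ℝ) ≤ ⌈(d * b / 16 : ℝ)⌉₊ := by
          refine le_trans ?_ (Nat.le_ceil _)
          have hdR : (10000 : ℝ) ≤ d := by exact_mod_cast hd
          have : (0 : ℝ) ≤ b := Nat.cast_nonneg _
          push_cast
          nlinarith
        exact_mod_cast this
      rw [Nat.cast_sum]
      have e4 := Finset.sum_le_card_nsmul (P b)
        (fun p => ((manyEdges d (pairsBetween p.1 p.2) ⌈(d * b / 16 : ℝ)⌉₊).card : ℝ))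
        ((700 * (b / n : ℝ)) ^ ⌈(d * b / 16 : ℝ)⌉₊ * N) fun p hp => by
          obtain ⟨hp1, hp2⟩ := Finset.mem_product.1 hp
          refine card_manyEdges_small_le hd hdn hb1 (hb2.trans (Nat.div_le_self _ _)) _
            not_isDiag_of_mem_pairsBetween ((card_pairsBetween_le _ _).trans (le_of_eq ?_))
          rw [Finset.mem_powersetCard_univ.1 hp1, Finset.mem_powersetCard_univ.1 hp2]
      refine e4.trans ?_
      rw [nsmul_eq_mul, hP, Finset.card_product, Finset.card_powersetCard,
        Finset.card_powersetCard, Finset.card_univ, Fintype.card_fin, ← mul_assoc]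
      push_cast
      calc (n.choose (8 * b) : ℝ) * n.choose b * (700 * (b / n : ℝ)) ^ ⌈(d * b / 16 : ℝ)⌉₊ * N
          ≤ (1 / 2) ^ b / n * N :=
            mul_le_mul_of_nonneg_right (choose_mul_choose_mul_pow_le hb1 hb2 hm) hN0
        _ = (1 / 2) ^ b * (N / n) := by ring
    refine e2.trans ?_
    rw [Nat.cast_sum]
    refine (Finset.sum_le_sum e3).trans ?_
    rw [← Finset.sum_mul]
    have e5 : ∑ b ∈ Finset.Icc 1 (n / 10 ^ 7), (1 / 2 : ℝ) ^ b ≤ 2 := by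
      refine le_trans ?_ (sum_geometric_two_le (n / 10 ^ 7 + 1))
      refine Finset.sum_le_sum_of_subset_of_nonneg ?_ fun b _ _ => by positivity
      intro b hb
      have := Finset.mem_Icc.1 hb
      exact Finset.mem_range.2 (by omega)
    calc (∑ b ∈ Finset.Icc 1 (n / 10 ^ 7), (1 / 2 : ℝ) ^ b) * (N / n) ≤ 2 * (N / n) := by gcongr
      _ = 2 / n * N := by ring
  have h3 : (((Finset.univ : Finset (RegularGraph n d)).filter fun G =>
      ¬ WellMixed G.val d 80 (1 / 10 ^ 7)).card : ℝ) ≤ U₁.card + U₂.card := by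
    exact_mod_cast (Finset.card_le_card hsub).trans (Finset.card_union_le _ _)
  calc _ ≤ (U₁.card : ℝ) + U₂.card := h3
    _ ≤ 1 / n * N + 2 / n * N := add_le_add h1 h2
    _ = 3 / n * N := by ring

end UnionBound

/-! ### Choice of constants and conclusion. -/

lemma shrinks_of_wellMixed {V : Type*} [Fintype V] {G : SimpleGraph V} {d : ℕ} {c δ K : ℝ}
    (hG : WellMixed G d c δ) (r : SamplingRule) (b : Bool) (hd : 16 ≤ d) (hc : 1 ≤ c)
    (hδ : 0 < δ) (hK : 20 * c ≤ K * δ) (hV : 0 < Fintype.card V) :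
    Shrinks r G b (K / Real.sqrt d) := fun x hx =>
  hG.sum_adoptFraction_le r x b hd hc hδ hK hV rfl hx

lemma leadOver_eq_imbalance {V : Type*} [Fintype V] (hV : 0 < Fintype.card V) {x : Config V}
    {a : Bool} (ha : IsMajority x a) : leadOver x (!a) = imbalance x := by
  have hV' : (0 : ℝ) < Fintype.card V := by exact_mod_cast hV
  have h1 := votes_add x a
  have h2 : (votes x a : ℝ) + votes x (!a) = Fintype.card V := by exact_mod_cast h1
  have h3 : (votes x (!a) : ℝ) < votes x a := by exact_mod_cast ha
  have h4 : |(votes x true : ℝ) - (votes x false : ℝ)| = votes x a - votes x (!a) := by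
    cases a
    · rw [abs_sub_comm]
      exact abs_of_pos (by simpa using h3)
    · exact abs_of_pos (by simpa using h3)
  unfold leadOver imbalance
  rw [h4, ← h2]
  field_simp [h2 ▸ hV'.ne']
  ring

lemma imbalance_le_one {V : Type*} [Fintype V] (x : Config V) : imbalance x ≤ 1 := by
  unfold imbalance
  refine div_le_one_of_le₀ ?_ (Nat.cast_nonneg _)
  have h2 : (votes x true : ℝ) + votes x false = Fintype.card V := by
    exact_mod_cast votes_add x true
  rw [abs_le]
  constructor <;> linarith [(Nat.cast_nonneg (votes x true) : (0 : ℝ) ≤ _),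
    (Nat.cast_nonneg (votes x false) : (0 : ℝ) ≤ _)]

/-- The failure probability after `100 log n` steps, split into two halves. -/
lemma failure_le {n : ℕ} (hn : 100 ≤ n) {ν : ℝ} (hν : 200 * n ≤ (n * ν ^ 2) ^ 2)
    (hν2 : 16384 * Real.sqrt n ≤ n * ν ^ 2) (hν0 : 0 < ν) {T₁ k : ℕ}
    (hT : T₁ + k = ⌊100 * Real.log n⌋₊) (hT₁ : T₁ = ⌊100 * Real.log n⌋₊ / 2) :
    1 / 2 ≤ ν * (17 / 16) ^ T₁ ∧
    n * (7 / 8 : ℝ) ^ k + n * (k * (T₁ + k) * Real.exp (-(n * ν ^ 2 / 16384)))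
      ≤ 10 ^ 9 / n := by
  have hnR : (100 : ℝ) ≤ n := by exact_mod_cast hn
  have hn0 : (0 : ℝ) < n := by linarith
  set l := Real.log n with hl
  have hl2 : 1 ≤ l := by
    rw [hl, Real.le_log_iff_exp_le hn0]
    linarith [Real.exp_one_lt_three]
  have hln : l ≤ n := (Real.log_le_sub_one_of_pos hn0).trans (by linarith)
  have hexp : Real.exp l = n := Real.exp_log hn0
  have hfl := Nat.floor_le (a := 100 * l) (by positivity)
  have hfl2 := Nat.lt_floor_add_one (100 * l)
  rw [← hT] at hfl hfl2
  push_cast at hfl hfl2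
  have hT1 : 40 * l ≤ T₁ := by
    have h1 : T₁ + k ≤ 2 * T₁ + 1 := by omega
    have h2 : (T₁ : ℝ) + k ≤ 2 * T₁ + 1 := by exact_mod_cast h1
    linarith
  have hk : 40 * l ≤ k := by
    have h1 : T₁ ≤ k := by omega
    have h2 : (T₁ : ℝ) ≤ k := by exact_mod_cast h1
    linarith
  constructor
  · have h1 : Real.exp (1 / 20) ≤ 17 / 16 := by
      have := Real.abs_exp_sub_one_sub_id_le (x := (1 / 20 : ℝ)) (by norm_num [abs_of_pos])
      have := (abs_le.1 this).2
      norm_num at this ⊢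
      linarith
    have h2 : (n : ℝ) ≤ (17 / 16) ^ T₁ := by
      calc (n : ℝ) = Real.exp l := hexp.symm
        _ ≤ Real.exp (T₁ * (1 / 20)) := Real.exp_le_exp.2 (by linarith)
        _ = Real.exp (1 / 20) ^ T₁ := Real.exp_nat_mul _ _
        _ ≤ (17 / 16) ^ T₁ := by gcongr
    -- The growth factor over `T₁` steps is at least `n`, so it suffices that `ν` is not below `1 /
    -- n`.
    have h3 : 1 ≤ n * ν := by
      by_contra h
      rw [not_le] at h
      have h4 : (n * ν) ^ 4 ≤ 1 := pow_le_one₀ (by positivity) h.le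
      have h5 : (n * ν ^ 2) ^ 2 * n ^ 2 = (n * ν) ^ 4 := by ring
      have h6 : 1 ≤ n * (n : ℝ) ^ 2 := by
        have : (1 : ℝ) ≤ (n : ℝ) ^ 2 := one_le_pow₀ (by linarith)
        nlinarith
      have h7 : 200 * n * (n : ℝ) ^ 2 ≤ (n * ν ^ 2) ^ 2 * n ^ 2 := by gcongr
      linarith
    have h4 : n * ν ≤ ν * (17 / 16) ^ T₁ := by
      rw [mul_comm]
      gcongr
    linarith
  · have h1 : n * (7 / 8 : ℝ) ^ k ≤ 1 / n := by
      have e1 : (7 / 8 : ℝ) ≤ Real.exp (-(1 / 8)) := by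
        have := Real.add_one_le_exp (-(1 / 8 : ℝ))
        linarith
      have e2 : (7 / 8 : ℝ) ^ k ≤ Real.exp (-(2 * l)) := by
        calc (7 / 8 : ℝ) ^ k ≤ Real.exp (-(1 / 8)) ^ k := by gcongr
          _ = Real.exp (k * -(1 / 8)) := (Real.exp_nat_mul _ _).symm
          _ ≤ Real.exp (-(2 * l)) := Real.exp_le_exp.2 (by linarith)
      have e3 : Real.exp (-(2 * l)) = 1 / (n * n) := by
        rw [Real.exp_neg, two_mul, Real.exp_add, hexp, one_div]
      calc n * (7 / 8 : ℝ) ^ k ≤ n * (1 / (n * n)) := by rw [← e3]; gcongr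
        _ = 1 / n := by field_simp
    have h2 : Real.exp (-(n * ν ^ 2 / 16384)) ≤ 40320 / (n : ℝ) ^ 4 := by
      have e1 : Real.exp (-(n * ν ^ 2 / 16384)) ≤ Real.exp (-Real.sqrt n) := by
        rw [Real.exp_le_exp]
        linarith
      refine e1.trans ?_
      -- The eighth term of the exponential series is `n ^ 4 / 8!`, which outweighs the prefactor of
      -- order `n ^ 3`.
      have e2 := Real.pow_div_factorial_le_exp (x := Real.sqrt n) (Real.sqrt_nonneg _) 8
      have e3 : Real.sqrt n ^ 8 = (n : ℝ) ^ 4 := by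
        rw [show 8 = 2 * 4 by norm_num, pow_mul, Real.sq_sqrt hn0.le]
      rw [e3] at e2
      have e4 : ((8 : ℕ).factorial : ℝ) = 40320 := by norm_num [Nat.factorial]
      rw [e4] at e2
      rw [Real.exp_neg, inv_le_comm₀ (Real.exp_pos _) (by positivity), inv_div]
      exact e2
    have h3 : n * (k * (T₁ + k) * Real.exp (-(n * ν ^ 2 / 16384)))
        ≤ n * ((100 * n) * (100 * n) * (40320 / (n : ℝ) ^ 4)) := by
      have hT0 : (0 : ℝ) ≤ T₁ := Nat.cast_nonneg _
      gcongr <;> linarith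
    have h4 : n * ((100 * n) * (100 * n) * (40320 / (n : ℝ) ^ 4)) = 403200000 / n := by
      field_simp
      norm_num
    have h5 : (1 : ℝ) / n + 403200000 / n ≤ 10 ^ 9 / n := by
      rw [← add_div]
      gcongr
      norm_num
    linarith

end TwoSampleVoting

end

theorem mainTheorem5 :
    ∃ K : ℝ, 0 < K ∧ ∃ C : ℝ, 0 < C ∧
      ∀ ε : ℝ, 0 < ε → ∃ N : ℕ, ∀ n : ℕ, N ≤ n →
        ∀ d : ℕ, 1 ≤ d → (d : ℝ) ≤ Real.sqrt n →
        ∀ [Nonempty (TwoSampleVoting.RegularGraph n d)],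
          1 - ε ≤ TwoSampleVoting.prob (TwoSampleVoting.randomRegularGraph n d) fun G =>
            ∀ (r : TwoSampleVoting.SamplingRule)
              (x₀ : TwoSampleVoting.Config (Fin n)) (a : Bool),
              K / Real.sqrt d ≤ TwoSampleVoting.imbalance x₀ →
              TwoSampleVoting.IsMajority x₀ a →
              ∀ σ : TwoSampleVoting.Adversary (Fin n), σ.Redistributes →
                TwoSampleVoting.WinsWithin r G.val σ x₀ a ⌊C * Real.log n⌋₊ (1 - ε) := by
  classical
  -- Half of `K` is the drift constant, subject to `20 * 80 ≤ 10 ^ 11 * (1 / 10 ^ 7)`; the other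
  -- factor `2` yields `ν ≤ 1/2` from an imbalance at most `1`.
  refine ⟨2 * 10 ^ 11, by norm_num, 100, by norm_num, fun ε hε =>
    ⟨max 100 ⌈10 ^ 9 / ε⌉₊, fun n hn d _ hdn _ => ?_⟩⟩
  have hn100 : 100 ≤ n := (le_max_left _ _).trans hn
  have hnR : (100 : ℝ) ≤ n := by exact_mod_cast hn100
  have hn0 : (0 : ℝ) < n := by linarith
  have hnε : 10 ^ 9 / n ≤ ε := by
    have h1 : 10 ^ 9 / ε ≤ n := (Nat.le_ceil _).trans (by exact_mod_cast (le_max_right _ _).trans hn)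
    rw [div_le_iff₀ hε] at h1
    rw [div_le_iff₀ hn0]
    linarith
  have hddR : (d : ℝ) * d ≤ n := by
    calc (d : ℝ) * d ≤ Real.sqrt n * Real.sqrt n := by gcongr
      _ = n := Real.mul_self_sqrt hn0.le
  have hV : 0 < Fintype.card (Fin n) := by rw [Fintype.card_fin]; omega
  rw [TwoSampleVoting.randomRegularGraph, TwoSampleVoting.prob_uniformOfFintype]
  set N : ℝ := (Fintype.card (TwoSampleVoting.RegularGraph n d) : ℝ) with hN
  have hN0 : 0 < N := by rw [hN]; exact_mod_cast Fintype.card_pos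
  rw [le_div_iff₀ hN0]
  by_cases hd : 10000 ≤ d
  · have hdR : (10000 : ℝ) ≤ d := by exact_mod_cast hd
    have hsd : 0 < Real.sqrt d := Real.sqrt_pos.2 (by linarith)
    have hcount := TwoSampleVoting.card_not_wellMixed_le (n := n) hd (by exact_mod_cast hddR)
    have hsplit : N = (((Finset.univ : Finset (TwoSampleVoting.RegularGraph n d)).filter fun G =>
          TwoSampleVoting.WellMixed G.val d 80 (1 / 10 ^ 7)).card : ℝ)
        + ((Finset.univ : Finset (TwoSampleVoting.RegularGraph n d)).filter fun G =>
          ¬ TwoSampleVoting.WellMixed G.val d 80 (1 / 10 ^ 7)).card := by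
      rw [hN, ← Finset.card_univ]
      exact_mod_cast (Finset.card_filter_add_card_filter_not _).symm
    have h3 : 3 / n * N ≤ ε * N := by
      refine mul_le_mul_of_nonneg_right (le_trans ?_ hnε) hN0.le
      gcongr
      norm_num
    have hgood : (1 - ε) * N ≤
        (((Finset.univ : Finset (TwoSampleVoting.RegularGraph n d)).filter fun G =>
          TwoSampleVoting.WellMixed G.val d 80 (1 / 10 ^ 7)).card : ℝ) := by linarith
    refine hgood.trans (Nat.cast_le.2 (Finset.card_le_card ?_))
    intro G hG
    refine Finset.mem_filter.2 ⟨Finset.mem_univ _, fun r x₀ a hx₀ ha σ hσ => ?_⟩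
    have hmix := (Finset.mem_filter.1 hG).2
    set ν : ℝ := 10 ^ 11 / Real.sqrt d with hν
    have hν0 : 0 < ν := by positivity
    have hx₀' : 2 * ν ≤ TwoSampleVoting.imbalance x₀ := by
      rw [hν, mul_div_assoc']
      exact hx₀
    have hν1 : ν ≤ 1 / 2 := by linarith [TwoSampleVoting.imbalance_le_one x₀]
    have hshr : TwoSampleVoting.Shrinks r G.val (!a) ν :=
      TwoSampleVoting.shrinks_of_wellMixed hmix r (!a) (by omega) (by norm_num) (by positivity)
        (by norm_num) hV
    have hlead : ν ≤ TwoSampleVoting.leadOver x₀ (!a) := by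
      rw [TwoSampleVoting.leadOver_eq_imbalance hV ha]
      linarith
    -- As `d ≤ √n`, `n ν²` is of order at least `√n`, which makes the Chernoff failures negligible.
    have hνsq : 10 ^ 22 * Real.sqrt n ≤ n * ν ^ 2 := by
      have e1 : n * ν ^ 2 = 10 ^ 22 * (n / d) := by
        rw [hν, div_pow, Real.sq_sqrt (by linarith)]
        ring
      rw [e1]
      gcongr
      rw [le_div_iff₀ (by linarith)]
      calc Real.sqrt n * d ≤ Real.sqrt n * Real.sqrt n := by gcongr
        _ = n := Real.mul_self_sqrt hn0.le
    have hsn := Real.sqrt_nonneg (n : ℝ)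
    have hνsq2 : 200 * n ≤ (n * ν ^ 2) ^ 2 := by
      have e1 : (10 ^ 22 * Real.sqrt n) ^ 2 ≤ (n * ν ^ 2) ^ 2 := by gcongr
      rw [mul_pow, Real.sq_sqrt hn0.le] at e1
      linarith
    set T := ⌊100 * Real.log n⌋₊ with hT
    have hTk : T / 2 + (T - T / 2) = T := by omega
    obtain ⟨hf1, hf2⟩ := TwoSampleVoting.failure_le hn100 hνsq2 (by linarith) hν0 hTk rfl
    have hwin := TwoSampleVoting.winsWithin_of_shrinks hV
      (fun v => TwoSampleVoting.samplePairs_nonempty r G.val v (by rw [G.nbrIn_univ]; omega))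
      hshr hν0 hν1 σ hσ x₀ hlead hf1 (T - T / 2) (ε := ε) (by
        rw [Fintype.card_fin]
        exact hf2.trans hnε)
    rwa [hTk] at hwin
  -- For `d < 10000` the required imbalance exceeds `1`, so every graph qualifies.
  · have hvac : ∀ x₀ : TwoSampleVoting.Config (Fin n),
        ¬ (2 * 10 ^ 11 / Real.sqrt d ≤ TwoSampleVoting.imbalance x₀) := by
      intro x₀ h
      have h1 := h.trans (TwoSampleVoting.imbalance_le_one x₀)
      have hd1 : (1 : ℝ) ≤ d := by exact_mod_cast ‹1 ≤ d›
      have hd2 : (d : ℝ) ≤ 10000 := by exact_mod_cast (not_le.1 hd).le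
      have hsd : 0 < Real.sqrt d := Real.sqrt_pos.2 (by linarith)
      rw [div_le_one hsd] at h1
      have h2 := Real.mul_self_sqrt (show (0 : ℝ) ≤ d by linarith)
      nlinarith
    rw [Finset.filter_true_of_mem fun G _ r x₀ a hx => absurd hx (hvac x₀), Finset.card_univ, ← hN]
    nlinarith
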